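/- Let $n\ge 1$ and let $\Omega\subset\mathbb R^n$ be a bounded domain (non-empty, open and connected). Let $L^2(\Omega)$, $H^1_0(\Omega)$ (the closure of $C_c^\infty(\Omega)$ in $H^1(\Omega)$) and $H(\mathrm{div};\Omega)=\{\tau\in L^2(\Omega)^n:\ \mathrm{div}\,\tau\in L^2(\Omega)\}$ denote the usual spaces of complex-valued functions and fields, with weak derivatives, and let $(\cdot,\cdot)$ be the $L^2$ scalar product. Consider the (non-symmetric) first-order system least-squares eigenvalue problem: find $\lambda\in\mathbb C$ and $u\in H^1_0(\Omega)$, $u\neq 0$, such that for some $\sigma\in H(\mathrm{div};\Omega)$ $$ \begin{cases} (\sigma,\tau)+(\mathrm{div}\,\sigma,\mathrm{div}\,\tau)-(\nabla u,\tau)=-\lambda\,(u,\mathrm{div}\,\tau) & \forall\,\tau\in H(\mathrm{div};\Omega),\\ -(\sigma,\nabla v)+(\nabla u,\nabla v)=0 & \forall\, v\in H^1_0(\Omega). \end{cases} $$ For $\lambda\in\mathbb C$ let the eigenspace $E_\lambda\subset H^1_0(\Omega)$ be the set of all $u\in H^1_0(\Omega)$ for which these equations hold with some $\sigma\in H(\mathrm{div};\Omega)$.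 Then all the eigenvalues are real and positive, every eigenspace has finite dimension, and the eigenvalues, each repeated as many times as the dimension of its eigenspace, form an infinite sequence $$0<\lambda_1<\lambda_2\le\lambda_3\le\cdots,\qquad \lambda_k\to+\infty .$$ Moreover the eigenspaces span $H^1_0(\Omega)$: the linear span of $\bigcup_k E_{\lambda_k}$ is dense in $H^1_0(\Omega)$ for the $H^1$ norm. -/

import Mathlib

open MeasureTheory TopologicalSpace Filter
open scoped Distributions ENNReal

noncomputable section

namespace FOSLS

/-- The Euclidean space `ℝⁿ`. -/
abbrev Rn (n : ℕ) : Type := EuclideanSpace ℝ (Fin n)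

variable {n : ℕ} (Ω : Opens (Rn n))

/-- Complex-valued `L²(Ω)`. -/
abbrev L2 : Type := Lp ℂ 2 (volume.restrict (Ω : Set (Rn n)))

/-- `L²(Ω)ⁿ`, square integrable complex vector fields. -/
abbrev L2vec : Type := Lp (EuclideanSpace ℂ (Fin n)) 2 (volume.restrict (Ω : Set (Rn n)))

/-- The classical partial derivative `∂φ/∂xᵢ`. -/
def pd (φ : Rn n → ℂ) (i : Fin n) (x : Rn n) : ℂ :=
  fderiv ℝ φ x (EuclideanSpace.single i 1)

variable {Ω}

/-- `g` is the weak gradient of `u` in `Ω`, tested with all `φ ∈ C_c^∞(Ω)`. -/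
def HasWeakGrad (u : L2 Ω) (g : L2vec Ω) : Prop :=
  ∀ (φ : 𝓓(Ω, ℂ)) (i : Fin n),
    ∫ x in (Ω : Set (Rn n)), u x * pd φ i x = -∫ x in (Ω : Set (Rn n)), g x i * φ x

/-- `d` is the weak divergence of `σ` in `Ω`, tested with all `φ ∈ C_c^∞(Ω)`. -/
def HasWeakDiv (σ : L2vec Ω) (d : L2 Ω) : Prop :=
  ∀ φ : 𝓓(Ω, ℂ),
    ∫ x in (Ω : Set (Rn n)), ∑ i, σ x i * pd φ i x = -∫ x in (Ω : Set (Rn n)), d x * φ x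

lemma memLp_test (φ : 𝓓(Ω, ℂ)) : MemLp φ 2 (volume.restrict (Ω : Set (Rn n))) :=
  (φ.contDiff.continuous.memLp_of_hasCompactSupport φ.hasCompactSupport).restrict _

lemma memLp_pd (φ : 𝓓(Ω, ℂ)) (i : Fin n) :
    MemLp (pd φ i) 2 (volume.restrict (Ω : Set (Rn n))) := by
  have hc : Continuous (pd φ i) :=
    (φ.contDiff.continuous_fderiv (by simp)).clm_apply continuous_const
  have hs : HasCompactSupport (pd φ i) := φ.hasCompactSupport.fderiv_apply ℝ _
  exact (hc.memLp_of_hasCompactSupport hs).restrict _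

lemma memLp_coord (g : L2vec Ω) (i : Fin n) :
    MemLp (fun x => g x i) 2 (volume.restrict (Ω : Set (Rn n))) :=
  (EuclideanSpace.proj (𝕜 := ℂ) i).comp_memLp' (Lp.memLp g)

lemma HasWeakGrad.add {u v : L2 Ω} {g h : L2vec Ω} (hu : HasWeakGrad u g)
    (hv : HasWeakGrad v h) : HasWeakGrad (u + v) (g + h) := by
  intro φ i
  have e1 : ∫ x in (Ω : Set (Rn n)), (u + v : L2 Ω) x * pd φ i x =
      ∫ x in (Ω : Set (Rn n)), (u x * pd φ i x + v x * pd φ i x) := by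
    refine integral_congr_ae ?_
    filter_upwards [Lp.coeFn_add u v] with x hx
    rw [hx, Pi.add_apply, add_mul]
  have e2 : ∫ x in (Ω : Set (Rn n)), (g + h : L2vec Ω) x i * φ x =
      ∫ x in (Ω : Set (Rn n)), (g x i * φ x + h x i * φ x) := by
    refine integral_congr_ae ?_
    filter_upwards [Lp.coeFn_add g h] with x hx
    rw [hx, Pi.add_apply, PiLp.add_apply, add_mul]
  have i1 := integral_add ((Lp.memLp u).integrable_mul (memLp_pd φ i))
    ((Lp.memLp v).integrable_mul (memLp_pd φ i))
  have i2 := integral_add ((memLp_coord g i).integrable_mul (memLp_test φ))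
    ((memLp_coord h i).integrable_mul (memLp_test φ))
  simp only [Pi.mul_apply] at i1 i2
  rw [e1, e2, i1, i2, hu φ i, hv φ i]
  ring

lemma HasWeakGrad.smul (c : ℂ) {u : L2 Ω} {g : L2vec Ω} (hu : HasWeakGrad u g) :
    HasWeakGrad (c • u) (c • g) := by
  intro φ i
  have e1 : ∫ x in (Ω : Set (Rn n)), (c • u : L2 Ω) x * pd φ i x =
      ∫ x in (Ω : Set (Rn n)), c * (u x * pd φ i x) := by
    refine integral_congr_ae ?_
    filter_upwards [Lp.coeFn_smul c u] with x hx
    rw [hx, Pi.smul_apply, smul_eq_mul, mul_assoc]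
  have e2 : ∫ x in (Ω : Set (Rn n)), (c • g : L2vec Ω) x i * φ x =
      ∫ x in (Ω : Set (Rn n)), c * (g x i * φ x) := by
    refine integral_congr_ae ?_
    filter_upwards [Lp.coeFn_smul c g] with x hx
    rw [hx, Pi.smul_apply, PiLp.smul_apply, smul_eq_mul, mul_assoc]
  rw [e1, e2, integral_const_mul, integral_const_mul, hu φ i, mul_neg]

lemma HasWeakDiv.add {σ τ : L2vec Ω} {d e : L2 Ω} (hσ : HasWeakDiv σ d)
    (hτ : HasWeakDiv τ e) : HasWeakDiv (σ + τ) (d + e) := by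
  intro φ
  have e1 : ∫ x in (Ω : Set (Rn n)), ∑ i, (σ + τ : L2vec Ω) x i * pd φ i x =
      ∫ x in (Ω : Set (Rn n)), ((∑ i, σ x i * pd φ i x) + ∑ i, τ x i * pd φ i x) := by
    refine integral_congr_ae ?_
    filter_upwards [Lp.coeFn_add σ τ] with x hx
    simp only [hx, Pi.add_apply, PiLp.add_apply, add_mul, Finset.sum_add_distrib]
  have e2 : ∫ x in (Ω : Set (Rn n)), (d + e : L2 Ω) x * φ x =
      ∫ x in (Ω : Set (Rn n)), (d x * φ x + e x * φ x) := by
    refine integral_congr_ae ?_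
    filter_upwards [Lp.coeFn_add d e] with x hx
    rw [hx, Pi.add_apply, add_mul]
  have i1 := integral_add
    (integrable_finsetSum Finset.univ fun i _ =>
      (memLp_coord σ i).integrable_mul (memLp_pd φ i))
    (integrable_finsetSum Finset.univ fun i _ =>
      (memLp_coord τ i).integrable_mul (memLp_pd φ i))
  have i2 := integral_add ((Lp.memLp d).integrable_mul (memLp_test φ))
    ((Lp.memLp e).integrable_mul (memLp_test φ))
  simp only [Pi.mul_apply] at i1 i2
  rw [e1, e2, i1, i2, hσ φ, hτ φ]
  ring

lemma HasWeakDiv.smul (c : ℂ) {σ : L2vec Ω} {d : L2 Ω} (hσ : HasWeakDiv σ d) :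
    HasWeakDiv (c • σ) (c • d) := by
  intro φ
  have e1 : ∫ x in (Ω : Set (Rn n)), ∑ i, (c • σ : L2vec Ω) x i * pd φ i x =
      ∫ x in (Ω : Set (Rn n)), c * ∑ i, σ x i * pd φ i x := by
    refine integral_congr_ae ?_
    filter_upwards [Lp.coeFn_smul c σ] with x hx
    simp only [hx, Pi.smul_apply, PiLp.smul_apply, smul_eq_mul, mul_assoc, Finset.mul_sum]
  have e2 : ∫ x in (Ω : Set (Rn n)), (c • d : L2 Ω) x * φ x =
      ∫ x in (Ω : Set (Rn n)), c * (d x * φ x) := by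
    refine integral_congr_ae ?_
    filter_upwards [Lp.coeFn_smul c d] with x hx
    rw [hx, Pi.smul_apply, smul_eq_mul, mul_assoc]
  rw [e1, e2, integral_const_mul, integral_const_mul, hσ φ, mul_neg]

lemma HasWeakGrad.zero : HasWeakGrad (0 : L2 Ω) 0 := by
  intro φ i
  have e1 : ∫ x in (Ω : Set (Rn n)), (0 : L2 Ω) x * pd φ i x = 0 := by
    refine integral_eq_zero_of_ae ?_
    filter_upwards [Lp.coeFn_zero ℂ 2 (volume.restrict (Ω : Set (Rn n)))] with x hx
    simp only [hx, Pi.zero_apply, zero_mul]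
  have e2 : ∫ x in (Ω : Set (Rn n)), (0 : L2vec Ω) x i * φ x = 0 := by
    refine integral_eq_zero_of_ae ?_
    filter_upwards [Lp.coeFn_zero (EuclideanSpace ℂ (Fin n)) 2
      (volume.restrict (Ω : Set (Rn n)))] with x hx
    simp only [hx, Pi.zero_apply, PiLp.zero_apply, zero_mul]
  rw [e1, e2, neg_zero]

lemma HasWeakDiv.zero : HasWeakDiv (0 : L2vec Ω) 0 := by
  intro φ
  have e1 : ∫ x in (Ω : Set (Rn n)), ∑ i, (0 : L2vec Ω) x i * pd φ i x = 0 := by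
    refine integral_eq_zero_of_ae ?_
    filter_upwards [Lp.coeFn_zero (EuclideanSpace ℂ (Fin n)) 2
      (volume.restrict (Ω : Set (Rn n)))] with x hx
    simp only [hx, Pi.zero_apply, PiLp.zero_apply, zero_mul, Finset.sum_const_zero]
  have e2 : ∫ x in (Ω : Set (Rn n)), (0 : L2 Ω) x * φ x = 0 := by
    refine integral_eq_zero_of_ae ?_
    filter_upwards [Lp.coeFn_zero ℂ 2 (volume.restrict (Ω : Set (Rn n)))] with x hx
    simp only [hx, Pi.zero_apply, zero_mul]
  rw [e1, e2, neg_zero]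

variable (Ω)

/-- The Sobolev space `H¹(Ω)`. A function `u` is recorded together with its (unique) weak
gradient, as the pair `(u, ∇u)`; the norm is `(‖u‖² + ‖∇u‖²)^{1/2}`. -/
def H1 : Submodule ℂ (WithLp 2 (L2 Ω × L2vec Ω)) where
  carrier := {w | HasWeakGrad w.fst w.snd}
  zero_mem' := HasWeakGrad.zero
  add_mem' := HasWeakGrad.add
  smul_mem' c _ h := HasWeakGrad.smul c h

/-- The space `C_c^∞(Ω)` inside `H¹(Ω)`: pairs `(φ, ∇φ)` with `φ` a test function. -/
def testPairs : Submodule ℂ (WithLp 2 (L2 Ω × L2vec Ω)) :=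
  Submodule.span ℂ {w | ∃ φ : 𝓓(Ω, ℂ),
    (w.fst =ᵐ[volume.restrict (Ω : Set (Rn n))] φ) ∧
    (w.snd =ᵐ[volume.restrict (Ω : Set (Rn n))] fun x => WithLp.toLp 2 fun i => pd φ i x)}

/-- `H¹₀(Ω)`: the closure of `C_c^∞(Ω)` in `H¹(Ω)`. -/
def H10 : Submodule ℂ (WithLp 2 (L2 Ω × L2vec Ω)) :=
  H1 Ω ⊓ (testPairs Ω).topologicalClosure

/-- The space `H(div; Ω)`: fields `σ ∈ L²(Ω)ⁿ` recorded together with their (unique) weak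
divergence in `L²(Ω)`, as pairs `(σ, div σ)`. -/
def Hdiv : Submodule ℂ (WithLp 2 (L2vec Ω × L2 Ω)) where
  carrier := {w | HasWeakDiv w.fst w.snd}
  zero_mem' := HasWeakDiv.zero
  add_mem' := HasWeakDiv.add
  smul_mem' c _ h := HasWeakDiv.smul c h

variable {Ω}

/-- The underlying `L²` function of `u ∈ H¹₀(Ω)`. -/
def fn (u : H10 Ω) : L2 Ω := u.1.fst

/-- The gradient of `u ∈ H¹₀(Ω)`. -/
def grad (u : H10 Ω) : L2vec Ω := u.1.snd

/-- The underlying `L²` vector field of `σ ∈ H(div; Ω)`. -/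
def vec (σ : Hdiv Ω) : L2vec Ω := σ.1.fst

/-- The divergence of `σ ∈ H(div; Ω)`. -/
def div (σ : Hdiv Ω) : L2 Ω := σ.1.snd

/-- The `L²` scalar product `(f, g) = ∫_Ω f · conj g`, linear in the first argument
(Mathlib's `inner` is linear in the second one). -/
def ip {E : Type*} [NormedAddCommGroup E] [InnerProductSpace ℂ E] (f g : E) : ℂ := inner ℂ g f

/-- The pair `(σ, u)` satisfies the variational equations of the FOSLS eigenproblem with
parameter `lam`. -/
structure SolvesF1 (lam : ℂ) (σ : Hdiv Ω) (u : H10 Ω) : Prop where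
  flux : ∀ τ : Hdiv Ω,
    ip (vec σ) (vec τ) + ip (div σ) (div τ) - ip (grad u) (vec τ) = -lam * ip (fn u) (div τ)
  potential : ∀ v : H10 Ω, -ip (vec σ) (grad v) + ip (grad u) (grad v) = 0

variable (Ω)

/-- `lam ∈ ℂ` is an eigenvalue of the FOSLS eigenproblem. -/
def IsEigenvalue (lam : ℂ) : Prop :=
  ∃ u : H10 Ω, fn u ≠ 0 ∧ ∃ σ : Hdiv Ω, SolvesF1 lam σ u

/-- The eigenspace of `lam`: all `u ∈ H¹₀(Ω)` that solve the eigenproblem for some `σ`. -/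
def eigenspace (lam : ℂ) : Submodule ℂ (H10 Ω) where
  carrier := {u | ∃ σ : Hdiv Ω, SolvesF1 lam σ u}
  zero_mem' := ⟨0, by
    constructor <;> intro _ <;> simp [ip, fn, grad, vec, div]⟩
  add_mem' := by
    rintro u v ⟨σ, hσ⟩ ⟨τ, hτ⟩
    refine ⟨σ + τ, ?_, ?_⟩ <;> intro w
    · have h1 := hσ.flux w
      have h2 := hτ.flux w
      simp only [ip, fn, grad, vec, div, Submodule.coe_add, WithLp.add_fst,
        WithLp.add_snd, inner_add_right] at h1 h2 ⊢
      linear_combination h1 + h2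
    · have h1 := hσ.potential w
      have h2 := hτ.potential w
      simp only [ip, grad, vec, Submodule.coe_add, WithLp.add_fst,
        WithLp.add_snd, inner_add_right] at h1 h2 ⊢
      linear_combination h1 + h2
  smul_mem' := by
    rintro c u ⟨σ, hσ⟩
    refine ⟨c • σ, ?_, ?_⟩ <;> intro w
    · have h1 := hσ.flux w
      simp only [ip, fn, grad, vec, div, Submodule.coe_smul, WithLp.smul_fst,
        WithLp.smul_snd, inner_smul_right] at h1 ⊢
      linear_combination c * h1
    · have h1 := hσ.potential w
      simp only [ip, grad, vec, Submodule.coe_smul, WithLp.smul_fst,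
        WithLp.smul_snd, inner_smul_right] at h1 ⊢
      linear_combination c * h1

end FOSLS

end

/-!
The proof has two parts: the eigenproblem is that of the Dirichlet Laplacian, and the Dirichlet
Laplacian on a bounded domain has the stated spectrum.

*Reduction.* The second equation says that `σ - ∇u` is orthogonal to all gradients of functions in
`H¹₀(Ω)`, hence divergence-free. It is then an admissible `τ` in the first equation, which gives
`‖σ - ∇u‖² = 0` (`SolvesF1.vec_eq_grad`). With `σ = ∇u` the first equation says that `div σ + λ u`
is orthogonal to all divergences. If `e` is a Dirichlet eigenfunction, then `div ∇e` is a nonzero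
multiple of `e`; the Dirichlet eigenfunctions are complete in `L²(Ω)`, so `div σ = -λ u`, that is
`-Δu = λ u` weakly (`mem_eigenspace_iff`).

*Spectrum.* The operator `S = (1 - Δ)⁻¹` on `H¹₀(Ω)` (`resolventOp`) is symmetric, injective, and
compact by Rellich's theorem (`isCompactOperator_fnL`). Rellich's theorem holds because averaging
over balls of radius `h` around finitely many centres is an operator of finite rank, and moves
`u ∈ H¹₀(Ω)` by `O(h) ‖∇u‖`, by the estimate `‖u(· + z) - u‖ ≤ |z| ‖∇u‖`. The spectral theorem for
compact symmetric operators gives finite multiplicities, eigenvalues without finite accumulation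
point, and completeness; positivity is the Poincaré inequality. A locally finite infinite multiset
of positive reals can be listed in increasing order (`exists_monotone_enumeration`).

*Simplicity of the least eigenvalue* `a` (`finrank_eigenspace_le_one`). The first eigenfunctions are
the functions of zero energy `‖∇u‖² - a ‖u‖²`, and the energy is nonnegative. If `u` is a first
eigenfunction, smooth approximations of `Re u` and `|Re u|` are minimizing sequences, so that these
functions are first eigenfunctions as well. Let `φ ≥ 0` run through such a minimizing sequence with
limit `f`. Testing with `ψ² / (φ + ε)` bounds `ψ ∇ log (1 + f / ε)` in `L²` uniformly in `ε`. After
division by `log (1 / ε)` the logarithm tends to the indicator function of `{f ≠ 0}` as `ε → 0`, and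
the gradient tends to zero. So this indicator has zero weak gradient, and is constant because `Ω`
is connected (`ae_eq_zero_or_ae_ne_zero`). This form of the strong maximum principle needs no
regularity of `f`. Applied to `|Re u| - Re u`, it shows that `Re u` has a sign; the same holds
for `i u`. Hence a first eigenfunction of mean zero vanishes, and the eigenspace is at most
one-dimensional.
-/

noncomputable section

open scoped ContDiff Topology InnerProductSpace

namespace FOSLS

variable {n : ℕ} {Ω : Opens (Rn n)}

/-! ### Test functions as elements of `H¹₀(Ω)` -/

/-- Composition of a test function with a smooth map fixing the origin. -/
def postcomp {E F : Type*} [NormedAddCommGroup E] [NormedSpace ℝ E] [NormedAddCommGroup F]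
    [NormedSpace ℝ F] (G : E → F) (hG : ContDiff ℝ ∞ G) (h0 : G 0 = 0) (φ : 𝓓(Ω, E)) :
    𝓓(Ω, F) where
  toFun := G ∘ φ
  contDiff' := hG.comp φ.contDiff
  hasCompactSupport' := φ.hasCompactSupport.comp_left h0
  tsupport_subset' := (tsupport_comp_subset h0 φ).trans φ.tsupport_subset

@[simp] lemma postcomp_apply {E F : Type*} [NormedAddCommGroup E] [NormedSpace ℝ E]
    [NormedAddCommGroup F] [NormedSpace ℝ F] (G : E → F) (hG : ContDiff ℝ ∞ G) (h0 : G 0 = 0)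
    (φ : 𝓓(Ω, E)) (x : Rn n) : postcomp G hG h0 φ x = G (φ x) := rfl

/-- The complex conjugate of a test function. -/
def conjTest (φ : 𝓓(Ω, ℂ)) : 𝓓(Ω, ℂ) :=
  postcomp (starRingEnd ℂ) Complex.conjCLE.contDiff (map_zero _) φ

@[simp] lemma conjTest_apply (φ : 𝓓(Ω, ℂ)) (x : Rn n) :
    conjTest φ x = starRingEnd ℂ (φ x) := rfl

/-- A real test function, seen as a complex one. -/
def ofRealTest (φ : 𝓓(Ω, ℝ)) : 𝓓(Ω, ℂ) :=
  postcomp Complex.ofReal Complex.ofRealCLM.contDiff Complex.ofReal_zero φ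

@[simp] lemma ofRealTest_apply (φ : 𝓓(Ω, ℝ)) (x : Rn n) : ofRealTest φ x = (φ x : ℂ) := rfl

lemma hasFDerivAt_test {F : Type*} [NormedAddCommGroup F] [NormedSpace ℝ F] (φ : 𝓓(Ω, F))
    (x : Rn n) : HasFDerivAt φ (fderiv ℝ φ x) x :=
  (φ.contDiff.differentiable (by simp)).differentiableAt.hasFDerivAt

lemma pd_conjTest (φ : 𝓓(Ω, ℂ)) (i : Fin n) (x : Rn n) :
    pd (conjTest φ) i x = starRingEnd ℂ (pd φ i x) := by
  have h : HasFDerivAt (conjTest φ) ((Complex.conjCLE : ℂ →L[ℝ] ℂ).comp (fderiv ℝ φ x)) x :=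
    (Complex.conjCLE : ℂ →L[ℝ] ℂ).hasFDerivAt.comp x (hasFDerivAt_test φ x)
  simp [pd, h.fderiv]

lemma pd_ofRealTest (φ : 𝓓(Ω, ℝ)) (i : Fin n) (x : Rn n) :
    pd (ofRealTest φ) i x = (fderiv ℝ φ x (EuclideanSpace.single i 1) : ℂ) := by
  have h : HasFDerivAt (ofRealTest φ) (Complex.ofRealCLM.comp (fderiv ℝ φ x)) x :=
    Complex.ofRealCLM.hasFDerivAt.comp x (hasFDerivAt_test φ x)
  simp [pd, h.fderiv]

/-- The classical gradient. -/
def classicalGrad (φ : Rn n → ℂ) (x : Rn n) : EuclideanSpace ℂ (Fin n) :=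
  WithLp.toLp 2 fun i => pd φ i x

lemma continuous_pd (φ : 𝓓(Ω, ℂ)) (i : Fin n) : Continuous (pd φ i) :=
  (φ.contDiff.continuous_fderiv (by simp)).clm_apply continuous_const

lemma continuous_classicalGrad (φ : 𝓓(Ω, ℂ)) : Continuous (classicalGrad φ) :=
  (PiLp.continuous_toLp 2 _).comp (continuous_pi fun i => continuous_pd φ i)

lemma pd_eq_zero (φ : 𝓓(Ω, ℂ)) (i : Fin n) {x : Rn n} (hx : x ∉ tsupport φ) : pd φ i x = 0 := by
  have : fderiv ℝ φ x = 0 :=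
    Function.notMem_support.mp fun h => hx (support_fderiv_subset ℝ h)
  simp [pd, this]

lemma classicalGrad_eq_zero (φ : 𝓓(Ω, ℂ)) {x : Rn n} (hx : x ∉ tsupport φ) :
    classicalGrad φ x = 0 := by
  ext i
  simp [classicalGrad, pd_eq_zero φ i hx]

lemma hasCompactSupport_classicalGrad (φ : 𝓓(Ω, ℂ)) : HasCompactSupport (classicalGrad φ) :=
  HasCompactSupport.intro φ.hasCompactSupport fun _ hx => classicalGrad_eq_zero φ hx

lemma memLp_classicalGrad (φ : 𝓓(Ω, ℂ)) :
    MemLp (classicalGrad φ) 2 (volume.restrict (Ω : Set (Rn n))) :=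
  ((continuous_classicalGrad φ).memLp_of_hasCompactSupport
    (hasCompactSupport_classicalGrad φ)).restrict _

lemma setIntegral_eq_integral_of_test {F : Type*} [NormedAddCommGroup F] [NormedSpace ℝ F]
    (φ : 𝓓(Ω, ℂ)) (f : Rn n → F) (hf : ∀ x ∉ tsupport φ, f x = 0) :
    ∫ x in (Ω : Set (Rn n)), f x = ∫ x, f x :=
  setIntegral_eq_integral_of_forall_compl_eq_zero fun x hx =>
    hf x fun h => hx (φ.tsupport_subset h)

/-- Integration by parts for test functions. -/
lemma integral_mul_pd (φ ψ : 𝓓(Ω, ℂ)) (i : Fin n) :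
    ∫ x in (Ω : Set (Rn n)), φ x * pd ψ i x = -∫ x in (Ω : Set (Rn n)), pd φ i x * ψ x := by
  rw [setIntegral_eq_integral_of_test φ, setIntegral_eq_integral_of_test φ]
  · refine integral_mul_fderiv_eq_neg_fderiv_mul_of_integrable ?_ ?_ ?_ ?_ ?_
    · exact ((continuous_pd φ i).mul ψ.continuous).integrable_of_hasCompactSupport
        (ψ.hasCompactSupport.mul_left)
    · exact (φ.continuous.mul (continuous_pd ψ i)).integrable_of_hasCompactSupport
        (φ.hasCompactSupport.mul_right)
    · exact (φ.continuous.mul ψ.continuous).integrable_of_hasCompactSupport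
        (φ.hasCompactSupport.mul_right)
    · exact fun x _ => (hasFDerivAt_test φ x).differentiableAt
    · exact fun x _ => (hasFDerivAt_test ψ x).differentiableAt
  · intro x hx
    rw [pd_eq_zero φ i hx, zero_mul]
  · intro x hx
    rw [image_eq_zero_of_notMem_tsupport hx, zero_mul]

lemma hasWeakGrad_test (φ : 𝓓(Ω, ℂ)) :
    HasWeakGrad (memLp_test φ).toLp (memLp_classicalGrad φ).toLp := by
  intro ψ i
  have h1 : ∫ x in (Ω : Set (Rn n)), (memLp_test φ).toLp _ x * pd ψ i x =
      ∫ x in (Ω : Set (Rn n)), φ x * pd ψ i x := by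
    refine integral_congr_ae ?_
    filter_upwards [(memLp_test φ).coeFn_toLp] with x hx
    rw [hx]
  have h2 : ∫ x in (Ω : Set (Rn n)), (memLp_classicalGrad φ).toLp _ x i * ψ x =
      ∫ x in (Ω : Set (Rn n)), pd φ i x * ψ x := by
    refine integral_congr_ae ?_
    filter_upwards [(memLp_classicalGrad φ).coeFn_toLp] with x hx
    rw [hx]
    rfl
  rw [h1, h2, integral_mul_pd]

/-- A test function, as an element of `H¹₀(Ω)`. -/
def ofTest (φ : 𝓓(Ω, ℂ)) : H10 Ω :=
  ⟨WithLp.toLp 2 ((memLp_test φ).toLp, (memLp_classicalGrad φ).toLp), hasWeakGrad_test φ,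
    Submodule.le_topologicalClosure _ (Submodule.subset_span
      ⟨φ, (memLp_test φ).coeFn_toLp, (memLp_classicalGrad φ).coeFn_toLp⟩)⟩

lemma fn_ofTest_ae (φ : 𝓓(Ω, ℂ)) : fn (ofTest φ) =ᵐ[volume.restrict (Ω : Set (Rn n))] φ :=
  (memLp_test φ).coeFn_toLp

lemma grad_ofTest_ae (φ : 𝓓(Ω, ℂ)) :
    grad (ofTest φ) =ᵐ[volume.restrict (Ω : Set (Rn n))] classicalGrad φ :=
  (memLp_classicalGrad φ).coeFn_toLp

/-- The function part, as a bounded operator `H¹₀(Ω) → L²(Ω)`. -/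
def fnL : H10 Ω →L[ℂ] L2 Ω := (WithLp.fstL 2 ℂ (L2 Ω) (L2vec Ω)).comp (H10 Ω).subtypeL

/-- The gradient part, as a bounded operator `H¹₀(Ω) → L²(Ω)ⁿ`. -/
def gradL : H10 Ω →L[ℂ] L2vec Ω := (WithLp.sndL 2 ℂ (L2 Ω) (L2vec Ω)).comp (H10 Ω).subtypeL

@[simp] lemma fnL_apply (u : H10 Ω) : fnL u = fn u := rfl

@[simp] lemma fn_add (u v : H10 Ω) : fn (u + v) = fn u + fn v := rfl
@[simp] lemma fn_sub (u v : H10 Ω) : fn (u - v) = fn u - fn v := rfl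
@[simp] lemma fn_smul (c : ℂ) (u : H10 Ω) : fn (c • u) = c • fn u := rfl
@[simp] lemma grad_add (u v : H10 Ω) : grad (u + v) = grad u + grad v := rfl
@[simp] lemma grad_sub (u v : H10 Ω) : grad (u - v) = grad u - grad v := rfl
@[simp] lemma grad_smul (c : ℂ) (u : H10 Ω) : grad (c • u) = c • grad u := rfl

/-- The inner product of `H¹₀(Ω)`. The shortcut keeps instance search from finding the
propositionally equal one that comes from the `C⋆`-module structure over `ℂ`. -/
instance : Inner ℂ (H10 Ω) := InnerProductSpace.toInner

lemma inner_H10 (u v : H10 Ω) : ⟪u, v⟫_ℂ = ⟪fn u, fn v⟫_ℂ + ⟪grad u, grad v⟫_ℂ :=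
  WithLp.prod_inner_apply u.1 v.1

lemma norm_sq_H10 (u : H10 Ω) : ‖u‖ ^ 2 = ‖fn u‖ ^ 2 + ‖grad u‖ ^ 2 :=
  WithLp.prod_norm_sq_eq_of_L2 u.1

lemma integral_mul_eq_inner {f : Rn n → ℂ} (hf : MemLp f 2 (volume.restrict (Ω : Set (Rn n))))
    (u : L2 Ω) : ∫ x in (Ω : Set (Rn n)), u x * f x = ⟪hf.star.toLp, u⟫_ℂ := by
  rw [L2.inner_def]
  refine integral_congr_ae ?_
  filter_upwards [hf.star.coeFn_toLp] with x hx
  rw [hx]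
  simp

lemma continuous_integral_mul {f : Rn n → ℂ}
    (hf : MemLp f 2 (volume.restrict (Ω : Set (Rn n)))) :
    Continuous fun u : L2 Ω => ∫ x in (Ω : Set (Rn n)), u x * f x := by
  simp_rw [integral_mul_eq_inner hf]
  exact continuous_const.inner continuous_id

/-- The `i`-th component of an `L²` vector field. -/
def coordL (i : Fin n) : L2vec Ω →L[ℂ] L2 Ω :=
  (EuclideanSpace.proj (𝕜 := ℂ) i).compLpL 2 (volume.restrict (Ω : Set (Rn n)))

lemma coordL_ae (i : Fin n) (g : L2vec Ω) :
    coordL i g =ᵐ[volume.restrict (Ω : Set (Rn n))] fun x => g x i :=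
  (EuclideanSpace.proj (𝕜 := ℂ) i).coeFn_compLp g

lemma continuous_integral_coord_mul {f : Rn n → ℂ} (i : Fin n)
    (hf : MemLp f 2 (volume.restrict (Ω : Set (Rn n)))) :
    Continuous fun g : L2vec Ω => ∫ x in (Ω : Set (Rn n)), g x i * f x := by
  refine ((continuous_integral_mul hf).comp (coordL (Ω := Ω) i).continuous).congr fun g => ?_
  refine integral_congr_ae ?_
  filter_upwards [coordL_ae i g] with x hx
  simp only [hx]

lemma isClosed_H1 : IsClosed (H1 Ω : Set (WithLp 2 (L2 Ω × L2vec Ω))) := by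
  have : (H1 Ω : Set (WithLp 2 (L2 Ω × L2vec Ω))) = ⋂ (φ : 𝓓(Ω, ℂ)), ⋂ (i : Fin n),
      {w | ∫ x in (Ω : Set (Rn n)), w.fst x * pd φ i x =
        -∫ x in (Ω : Set (Rn n)), w.snd x i * φ x} := by
    ext w
    simp only [Set.mem_iInter]
    rfl
  rw [this]
  refine isClosed_iInter fun φ => isClosed_iInter fun i => isClosed_eq ?_ ?_
  · exact (continuous_integral_mul (memLp_pd φ i)).comp
      (WithLp.fstL 2 ℂ (L2 Ω) (L2vec Ω)).continuous
  · exact ((continuous_integral_coord_mul i (memLp_test φ)).comp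
      (WithLp.sndL 2 ℂ (L2 Ω) (L2vec Ω)).continuous).neg

instance : CompleteSpace (H10 Ω) := by
  have : IsClosed (H10 Ω : Set (WithLp 2 (L2 Ω × L2vec Ω))) := by
    rw [H10, Submodule.coe_inf]
    exact isClosed_H1.inter (Submodule.isClosed_topologicalClosure _)
  exact this.completeSpace_coe

lemma pd_add (φ ψ : 𝓓(Ω, ℂ)) (i : Fin n) (x : Rn n) :
    pd (φ + ψ : 𝓓(Ω, ℂ)) i x = pd φ i x + pd ψ i x := by
  have h : HasFDerivAt (φ + ψ : 𝓓(Ω, ℂ)) (fderiv ℝ φ x + fderiv ℝ ψ x) x :=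
    (hasFDerivAt_test φ x).add (hasFDerivAt_test ψ x)
  rw [pd, h.fderiv]
  rfl

lemma pd_smul (c : ℂ) (φ : 𝓓(Ω, ℂ)) (i : Fin n) (x : Rn n) :
    pd (c • φ : 𝓓(Ω, ℂ)) i x = c * pd φ i x := by
  have h : HasFDerivAt (c • φ : 𝓓(Ω, ℂ)) (c • fderiv ℝ φ x) x :=
    (hasFDerivAt_test φ x).const_smul c
  rw [pd, h.fderiv]
  rfl

/-- The span of the test pairs contains nothing but test pairs. -/
lemma exists_ofTest_of_mem_testPairs {w : WithLp 2 (L2 Ω × L2vec Ω)} (hw : w ∈ testPairs Ω) :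
    ∃ φ : 𝓓(Ω, ℂ), w = ofTest φ := by
  have key : ∀ (w : WithLp 2 (L2 Ω × L2vec Ω)) (φ : 𝓓(Ω, ℂ)),
      (w.fst =ᵐ[volume.restrict (Ω : Set (Rn n))] φ) →
      (w.snd =ᵐ[volume.restrict (Ω : Set (Rn n))] classicalGrad φ) → w = ofTest φ := by
    intro w φ h1 h2
    refine (WithLp.ofLp_injective 2) (Prod.ext ?_ ?_)
    · exact Lp.ext (h1.trans (fn_ofTest_ae φ).symm)
    · exact Lp.ext (h2.trans (grad_ofTest_ae φ).symm)
  rw [testPairs] at hw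
  induction hw using Submodule.span_induction with
  | mem w h =>
    obtain ⟨φ, h1, h2⟩ := h
    exact ⟨φ, key w φ h1 h2⟩
  | zero =>
    refine ⟨0, key _ _ ?_ ?_⟩
    · exact Lp.coeFn_zero _ _ _
    · refine (Lp.coeFn_zero _ _ _).trans (Eventually.of_forall fun x => ?_)
      ext i
      simp [classicalGrad, pd]
  | add _ _ _ _ h1 h2 =>
    obtain ⟨φ, rfl⟩ := h1
    obtain ⟨ψ, rfl⟩ := h2
    refine ⟨φ + ψ, key _ _ ?_ ?_⟩
    · filter_upwards [Lp.coeFn_add (fn (ofTest φ)) (fn (ofTest ψ)), fn_ofTest_ae φ,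
        fn_ofTest_ae ψ] with x h h1 h2
      exact h.trans (by simp [h1, h2])
    · filter_upwards [Lp.coeFn_add (grad (ofTest φ)) (grad (ofTest ψ)), grad_ofTest_ae φ,
        grad_ofTest_ae ψ] with x h h1 h2
      refine h.trans ?_
      ext i
      simpa [h1, h2, classicalGrad] using (pd_add φ ψ i x).symm
  | smul c _ _ h =>
    obtain ⟨φ, rfl⟩ := h
    refine ⟨c • φ, key _ _ ?_ ?_⟩
    · filter_upwards [Lp.coeFn_smul c (fn (ofTest φ)), fn_ofTest_ae φ] with x h h1
      exact h.trans (by simp [h1])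
    · filter_upwards [Lp.coeFn_smul c (grad (ofTest φ)), grad_ofTest_ae φ] with x h h1
      refine h.trans ?_
      ext i
      simpa [h1, classicalGrad] using (pd_smul c φ i x).symm

lemma denseRange_ofTest : DenseRange (ofTest : 𝓓(Ω, ℂ) → H10 Ω) := by
  intro u
  rw [mem_closure_iff_seq_limit]
  obtain ⟨w, hw, hlim⟩ := mem_closure_iff_seq_limit.mp u.2.2
  choose φ hφ using fun k => exists_ofTest_of_mem_testPairs (hw k)
  refine ⟨fun k => ofTest (φ k), fun k => ⟨φ k, rfl⟩, tendsto_subtype_rng.mpr ?_⟩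
  exact hlim.congr fun k => hφ k

lemma exists_seq_ofTest (u : H10 Ω) :
    ∃ φ : ℕ → 𝓓(Ω, ℂ), Tendsto (fun k => ofTest (φ k)) atTop (𝓝 u) := by
  obtain ⟨w, hw, hlim⟩ := mem_closure_iff_seq_limit.mp (denseRange_ofTest u)
  choose φ hφ using hw
  exact ⟨φ, by simpa only [hφ] using hlim⟩

/-- An `L²` function whose integral against every test function is zero vanishes. -/
lemma ae_eq_zero_of_integral_test {f : Rn n → ℂ}
    (hf : MemLp f 2 (volume.restrict (Ω : Set (Rn n))))
    (h : ∀ φ : 𝓓(Ω, ℂ), ∫ x in (Ω : Set (Rn n)), f x * φ x = 0) :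
    f =ᵐ[volume.restrict (Ω : Set (Rn n))] 0 := by
  have hloc : LocallyIntegrableOn f Ω (volume : Measure (Rn n)) := by
    rw [locallyIntegrableOn_iff Ω.isOpen.isLocallyClosed]
    intro K hKΩ hK
    have h2 : MemLp f 2 (volume.restrict K) := hf.mono_measure (Measure.restrict_mono hKΩ le_rfl)
    have : IsFiniteMeasure (volume.restrict K) := ⟨by simpa using hK.measure_lt_top⟩
    exact h2.integrable (by norm_num)
  have := Ω.isOpen.ae_eq_zero_of_integral_contDiff_smul_eq_zero hloc fun g hg hc hs => by
    have := h (ofRealTest ⟨g, hg, hc, hs⟩)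
    rw [← this, setIntegral_eq_integral_of_forall_compl_eq_zero]
    · refine integral_congr_ae (Eventually.of_forall fun x => ?_)
      simp [mul_comm]
    · intro x hx
      have : g x = 0 := image_eq_zero_of_notMem_tsupport fun h' => hx (hs h')
      simp [this]
  exact (ae_restrict_iff' Ω.isOpen.measurableSet).mpr this

lemma grad_eq_zero_of_fn_eq_zero {u : H10 Ω} (hu : fn u = 0) : grad u = 0 := by
  have hw : HasWeakGrad (fn u) (grad u) := u.2.1
  have h : ∀ i, ∀ᵐ x ∂(volume.restrict (Ω : Set (Rn n))), grad u x i = 0 := fun i => by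
    refine ae_eq_zero_of_integral_test (memLp_coord (grad u) i) fun φ => ?_
    have h1 := hw φ i
    rw [hu, integral_mul_eq_inner (memLp_pd φ i), inner_zero_right] at h1
    exact neg_eq_zero.mp h1.symm
  refine Lp.ext ?_
  filter_upwards [ae_all_iff.mpr h, Lp.coeFn_zero (EuclideanSpace ℂ (Fin n)) 2
    (volume.restrict (Ω : Set (Rn n)))] with x hx h0
  rw [h0]
  ext i
  simpa using hx i

/-- An element of `H¹₀(Ω)` is determined by its function part, as weak gradients are unique. -/
lemma fn_eq_zero_iff {u : H10 Ω} : fn u = 0 ↔ u = 0 := by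
  refine ⟨fun h => ?_, fun h => h ▸ rfl⟩
  have := norm_sq_H10 u
  rw [h, grad_eq_zero_of_fn_eq_zero h] at this
  simpa using this

lemma inner_grad_ofTest (φ : 𝓓(Ω, ℂ)) (σ : L2vec Ω) :
    ⟪grad (ofTest φ), σ⟫_ℂ = ∫ x in (Ω : Set (Rn n)), ∑ i, σ x i * pd (conjTest φ) i x := by
  rw [L2.inner_def]
  refine integral_congr_ae ?_
  filter_upwards [grad_ofTest_ae φ] with x hx
  rw [hx, PiLp.inner_apply]
  simp [classicalGrad, pd_conjTest]

lemma inner_fn_ofTest (φ : 𝓓(Ω, ℂ)) (d : L2 Ω) :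
    ⟪fn (ofTest φ), d⟫_ℂ = ∫ x in (Ω : Set (Rn n)), d x * conjTest φ x := by
  rw [L2.inner_def]
  refine integral_congr_ae ?_
  filter_upwards [fn_ofTest_ae φ] with x hx
  rw [hx]
  simp

/-- The weak divergence is minus the adjoint of the gradient on `H¹₀(Ω)`. -/
lemma hasWeakDiv_iff {σ : L2vec Ω} {d : L2 Ω} :
    HasWeakDiv σ d ↔ ∀ v : H10 Ω, ⟪grad v, σ⟫_ℂ = -⟪fn v, d⟫_ℂ := by
  constructor
  · intro h v
    refine denseRange_ofTest.induction_on (p := fun v => ⟪grad v, σ⟫_ℂ = -⟪fn v, d⟫_ℂ) v ?_ ?_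
    · exact isClosed_eq (gradL.continuous.inner continuous_const)
        (fnL.continuous.inner continuous_const).neg
    · intro φ
      rw [inner_grad_ofTest, inner_fn_ofTest, h]
  · intro h φ
    have h1 := h (ofTest (conjTest φ))
    have h2 : conjTest (conjTest φ) = φ := by ext x; simp
    rwa [inner_grad_ofTest, inner_fn_ofTest, h2] at h1

/-! ### Translation estimate and the Poincaré inequality -/

/-- The Cauchy–Schwarz inequality `(∫ g)² ≤ μ(X) ∫ g²`. -/
lemma sq_lintegral_le {α : Type*} [MeasurableSpace α] (μ : Measure α) {g : α → ℝ≥0∞}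
    (hg : AEMeasurable g μ) : (∫⁻ x, g x ∂μ) ^ 2 ≤ μ Set.univ * ∫⁻ x, g x ^ 2 ∂μ := by
  have h := ENNReal.lintegral_mul_le_Lp_mul_Lq μ Real.HolderConjugate.two_two
    (aemeasurable_const (b := (1 : ℝ≥0∞))) hg
  simp only [Pi.mul_apply, one_mul, ENNReal.one_rpow, lintegral_const] at h
  calc (∫⁻ x, g x ∂μ) ^ 2 ≤ (μ Set.univ ^ (1 / 2 : ℝ) *
        (∫⁻ x, g x ^ (2 : ℝ) ∂μ) ^ (1 / 2 : ℝ)) ^ 2 := by gcongr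
    _ = μ Set.univ * ∫⁻ x, g x ^ 2 ∂μ := by
        rw [← ENNReal.mul_rpow_of_nonneg _ _ (by norm_num), ← ENNReal.rpow_natCast,
          ← ENNReal.rpow_mul]
        norm_num

lemma enorm_sq_eq_lintegral {α E : Type*} [MeasurableSpace α] {μ : Measure α}
    [NormedAddCommGroup E] (f : Lp E 2 μ) : ‖f‖ₑ ^ 2 = ∫⁻ x, ‖f x‖ₑ ^ 2 ∂μ := by
  have := eLpNorm_nnreal_pow_eq_lintegral (f := f) (μ := μ) (p := 2) (by norm_num)
  rw [Lp.enorm_def]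
  simpa using this

/-- The gradient is complex, so the directional derivative is its pairing with the complexified
direction. -/
lemma enorm_fderiv_apply_le (φ : 𝓓(Ω, ℂ)) (y z : Rn n) :
    ‖fderiv ℝ φ y z‖ₑ ≤ ‖z‖ₑ * ‖classicalGrad φ y‖ₑ := by
  have hz : z = ∑ i, z i • EuclideanSpace.single i (1 : ℝ) := by
    simpa using ((EuclideanSpace.basisFun (Fin n) ℝ).sum_repr z).symm
  set zc : EuclideanSpace ℂ (Fin n) := WithLp.toLp 2 fun i => (z i : ℂ) with hzc
  have h1 : fderiv ℝ φ y z = ⟪zc, classicalGrad φ y⟫_ℂ := by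
    conv_lhs => rw [hz]
    simp [PiLp.inner_apply, classicalGrad, hzc, pd, mul_comm]
  have h2 : ‖zc‖ = ‖z‖ := by
    simp [EuclideanSpace.norm_eq, hzc]
  rw [h1, ← ofReal_norm, ← ofReal_norm, ← ofReal_norm, ← ENNReal.ofReal_mul (norm_nonneg _),
    ← h2]
  exact ENNReal.ofReal_le_ofReal (norm_inner_le_norm _ _)

/-- Translating a test function by `z` moves it in `L²` by at most `|z| ‖∇φ‖`. -/
lemma lintegral_translate_sub_le (φ : 𝓓(Ω, ℂ)) (z : Rn n) :
    ∫⁻ x, ‖φ (x + z) - φ x‖ₑ ^ 2 ≤ ‖z‖ₑ ^ 2 * ∫⁻ x, ‖classicalGrad φ x‖ₑ ^ 2 := by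
  have hcont : Continuous fun p : Rn n × ℝ => ‖classicalGrad φ (p.1 + p.2 • z)‖ₑ ^ 2 :=
    (ENNReal.continuous_pow 2).comp ((continuous_classicalGrad φ).comp (by fun_prop)).enorm
  have hpt : ∀ x, ‖φ (x + z) - φ x‖ₑ ^ 2 ≤
      ‖z‖ₑ ^ 2 * ∫⁻ t in Set.Ioc (0 : ℝ) 1, ‖classicalGrad φ (x + t • z)‖ₑ ^ 2 := by
    intro x
    have hd : ∀ t ∈ Set.uIcc (0 : ℝ) 1, HasDerivAt (fun t : ℝ => φ (x + t • z))
        (fderiv ℝ φ (x + t • z) z) t := by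
      intro t _
      have h1 : HasDerivAt (fun t : ℝ => x + t • z) z t := by
        simpa using ((hasDerivAt_id t).smul_const z).const_add x
      exact (hasFDerivAt_test φ _).comp_hasDerivAt t h1
    have hc : Continuous fun t : ℝ => fderiv ℝ φ (x + t • z) z :=
      ((φ.contDiff.continuous_fderiv (by simp)).comp (by fun_prop)).clm_apply continuous_const
    have h0 := intervalIntegral.integral_eq_sub_of_hasDerivAt hd (hc.intervalIntegrable _ _)
    simp only [one_smul, zero_smul, add_zero] at h0
    rw [← h0, intervalIntegral.integral_of_le zero_le_one]
    have hm : Measurable fun t : ℝ => ‖classicalGrad φ (x + t • z)‖ₑ :=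
      ((continuous_classicalGrad φ).comp (by fun_prop)).enorm.measurable
    calc ‖∫ t in Set.Ioc (0 : ℝ) 1, fderiv ℝ φ (x + t • z) z‖ₑ ^ 2
        ≤ (∫⁻ t in Set.Ioc (0 : ℝ) 1, ‖z‖ₑ * ‖classicalGrad φ (x + t • z)‖ₑ) ^ 2 := by
          gcongr
          exact (enorm_integral_le_lintegral_enorm _).trans
            (lintegral_mono fun t => enorm_fderiv_apply_le φ _ z)
      _ = ‖z‖ₑ ^ 2 * (∫⁻ t in Set.Ioc (0 : ℝ) 1, ‖classicalGrad φ (x + t • z)‖ₑ) ^ 2 := by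
          rw [lintegral_const_mul _ hm, mul_pow]
      _ ≤ _ := by
          gcongr
          refine (sq_lintegral_le _ hm.aemeasurable).trans_eq ?_
          simp
  calc ∫⁻ x, ‖φ (x + z) - φ x‖ₑ ^ 2
      ≤ ∫⁻ x, ‖z‖ₑ ^ 2 * ∫⁻ t in Set.Ioc (0 : ℝ) 1, ‖classicalGrad φ (x + t • z)‖ₑ ^ 2 :=
        lintegral_mono hpt
    _ = ‖z‖ₑ ^ 2 * ∫⁻ x, ∫⁻ t in Set.Ioc (0 : ℝ) 1, ‖classicalGrad φ (x + t • z)‖ₑ ^ 2 :=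
        lintegral_const_mul' _ _ (by finiteness)
    _ = ‖z‖ₑ ^ 2 * ∫⁻ t in Set.Ioc (0 : ℝ) 1, ∫⁻ x, ‖classicalGrad φ (x + t • z)‖ₑ ^ 2 := by
        rw [lintegral_lintegral_swap hcont.measurable.aemeasurable]
    _ = ‖z‖ₑ ^ 2 * ∫⁻ x, ‖classicalGrad φ x‖ₑ ^ 2 := by
        congr 1
        have : ∀ t : ℝ, ∫⁻ x, ‖classicalGrad φ (x + t • z)‖ₑ ^ 2 =
            ∫⁻ x, ‖classicalGrad φ x‖ₑ ^ 2 := fun t =>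
          lintegral_add_right_eq_self (fun x => ‖classicalGrad φ x‖ₑ ^ 2) (t • z)
        simp [this]

lemma setLIntegral_enorm_sq_of_test {E : Type*} [NormedAddCommGroup E] (φ : 𝓓(Ω, ℂ))
    (f : Rn n → E) (hf : ∀ x ∉ tsupport φ, f x = 0) :
    ∫⁻ x in (Ω : Set (Rn n)), ‖f x‖ₑ ^ 2 = ∫⁻ x, ‖f x‖ₑ ^ 2 := by
  refine setLIntegral_eq_of_support_subset fun x hx => ?_
  by_contra h
  exact hx (by simp [hf x fun h' => h (φ.tsupport_subset h')])

lemma enorm_sq_fn_ofTest (φ : 𝓓(Ω, ℂ)) : ‖fn (ofTest φ)‖ₑ ^ 2 = ∫⁻ x, ‖φ x‖ₑ ^ 2 := by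
  rw [enorm_sq_eq_lintegral, ← setLIntegral_enorm_sq_of_test φ φ
    fun x hx => image_eq_zero_of_notMem_tsupport hx]
  refine lintegral_congr_ae ?_
  filter_upwards [fn_ofTest_ae φ] with x hx
  rw [hx]

lemma enorm_sq_grad_ofTest (φ : 𝓓(Ω, ℂ)) :
    ‖grad (ofTest φ)‖ₑ ^ 2 = ∫⁻ x, ‖classicalGrad φ x‖ₑ ^ 2 := by
  rw [enorm_sq_eq_lintegral, ← setLIntegral_enorm_sq_of_test φ _
    fun x hx => classicalGrad_eq_zero φ hx]
  refine lintegral_congr_ae ?_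
  filter_upwards [grad_ofTest_ae φ] with x hx
  rw [hx]

/-- The Poincaré inequality on a bounded set: a translation longer than the diameter moves a
function off its own support. -/
lemma exists_poincare (hn : 1 ≤ n) (hbdd : Bornology.IsBounded (Ω : Set (Rn n))) :
    ∃ C : ℝ, 0 ≤ C ∧ ∀ u : H10 Ω, ‖fn u‖ ≤ C * ‖grad u‖ := by
  obtain ⟨R, hR⟩ := hbdd.subset_ball (0 : Rn n)
  set i : Fin n := ⟨0, hn⟩
  set z : Rn n := EuclideanSpace.single i (2 * |R|) with hz
  have hznorm : ‖z‖ = 2 * |R| := by simp [hz]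
  have hdisj : ∀ x, x ∈ (Ω : Set (Rn n)) → x + z ∉ (Ω : Set (Rn n)) := by
    intro x hx hxz
    have h1 := hR hx
    have h2 := hR hxz
    rw [Metric.mem_ball, dist_zero_right] at h1 h2
    have h3 : ‖z‖ ≤ ‖x + z‖ + ‖x‖ := by
      simpa using norm_sub_le (x + z) x
    have := le_abs_self R
    linarith
  refine ⟨‖z‖, norm_nonneg _, fun u => ?_⟩
  refine denseRange_ofTest.induction_on (p := fun u => ‖fn u‖ ≤ ‖z‖ * ‖grad u‖) u ?_ ?_
  · exact isClosed_le fnL.continuous.norm (continuous_const.mul gradL.continuous.norm)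
  intro φ
  have h1 := lintegral_translate_sub_le φ z
  have h2 : ∫⁻ x, ‖φ x‖ₑ ^ 2 ≤ ∫⁻ x, ‖φ (x + z) - φ x‖ₑ ^ 2 := by
    calc ∫⁻ x, ‖φ x‖ₑ ^ 2 = ∫⁻ x in (Ω : Set (Rn n)), ‖φ x‖ₑ ^ 2 :=
          (setLIntegral_enorm_sq_of_test φ φ
            fun x hx => image_eq_zero_of_notMem_tsupport hx).symm
      _ = ∫⁻ x in (Ω : Set (Rn n)), ‖φ (x + z) - φ x‖ₑ ^ 2 := by
          refine setLIntegral_congr_fun Ω.isOpen.measurableSet fun x hx => ?_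
          have : φ (x + z) = 0 := image_eq_zero_of_notMem_tsupport
            fun h => hdisj x hx (φ.tsupport_subset h)
          simp [this]
      _ ≤ _ := setLIntegral_le_lintegral _ _
  rw [← enorm_sq_grad_ofTest, ← mul_pow] at h1
  rw [← enorm_sq_fn_ofTest] at h2
  have h3 : ‖fn (ofTest φ)‖ₑ ≤ ‖z‖ₑ * ‖grad (ofTest φ)‖ₑ :=
    (ENNReal.pow_right_strictMono two_ne_zero).le_iff_le.mp (h2.trans h1)
  rw [← ofReal_norm, ← ofReal_norm, ← ofReal_norm, ← ENNReal.ofReal_mul (norm_nonneg _)] at h3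
  exact (ENNReal.ofReal_le_ofReal_iff (by positivity)).mp h3

/-! ### Rellich's theorem -/

/-- A simple function that moves every point of a bounded set by less than `h`. -/
lemma exists_simpleFunc_dist_lt (hbdd : Bornology.IsBounded (Ω : Set (Rn n))) {h : ℝ}
    (hh : 0 < h) : ∃ c : SimpleFunc (Rn n) (Rn n), ∀ x ∈ Ω, dist x (c x) < h := by
  have hK : IsCompact (closure (Ω : Set (Rn n))) := hbdd.isCompact_closure
  obtain ⟨t, ht⟩ := hK.elim_finite_subcover
    (fun k : ℕ => Metric.ball (denseSeq (Rn n) k) h) (fun _ => Metric.isOpen_ball)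
    (fun x _ => by
      obtain ⟨k, hk⟩ := (denseRange_denseSeq (Rn n)).exists_dist_lt x hh
      exact Set.mem_iUnion.mpr ⟨k, hk⟩)
  refine ⟨SimpleFunc.nearestPt (denseSeq (Rn n)) (t.sup id), fun x hx => ?_⟩
  obtain ⟨k, hk, hxk⟩ := Set.mem_iUnion₂.mp (ht (subset_closure hx))
  have h1 := SimpleFunc.edist_nearestPt_le (denseSeq (Rn n)) x (Finset.le_sup (f := id) hk)
  rw [edist_dist, edist_dist, ENNReal.ofReal_le_ofReal_iff dist_nonneg] at h1
  rw [dist_comm]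
  refine h1.trans_lt ?_
  rw [dist_comm]
  exact hxk

/-- The operator `u ↦ (x ↦ ⨍_{B(c(x), h)} u)`, with `u` extended by zero outside `Ω`. It has
finite rank because `c` takes finitely many values. -/
def averageOp [IsFiniteMeasure (volume.restrict (Ω : Set (Rn n)))]
    (c : SimpleFunc (Rn n) (Rn n)) (h : ℝ) : L2 Ω →L[ℂ] L2 Ω :=
  ∑ y ∈ c.range, (innerSL ℂ (indicatorConstLp 2 (measurableSet_ball (x := y) (ε := h))
    (measure_ne_top _ _) ((volume (Metric.ball y h)).toReal⁻¹ : ℂ) : L2 Ω)).smulRight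
    (indicatorConstLp 2 (c.measurableSet_fiber y) (measure_ne_top _ _) (1 : ℂ) : L2 Ω)

lemma isCompactOperator_averageOp [IsFiniteMeasure (volume.restrict (Ω : Set (Rn n)))]
    (c : SimpleFunc (Rn n) (Rn n)) (h : ℝ) :
    IsCompactOperator (averageOp c h : L2 Ω →L[ℂ] L2 Ω) := by
  refine Submodule.sum_mem (compactOperator (RingHom.id ℂ) (L2 Ω) (L2 Ω)) fun y _ => ?_
  exact (isCompactOperator_of_locallyCompactSpace_dom
    (innerSL ℂ (indicatorConstLp 2 (measurableSet_ball (x := y) (ε := h))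
    (measure_ne_top _ _) ((volume (Metric.ball y h)).toReal⁻¹ : ℂ) : L2 Ω))).clm_comp
    (ContinuousLinearMap.toSpanSingleton ℂ (indicatorConstLp 2 (c.measurableSet_fiber y)
      (measure_ne_top _ _) (1 : ℂ) : L2 Ω))

lemma averageOp_ofTest_ae [IsFiniteMeasure (volume.restrict (Ω : Set (Rn n)))]
    (c : SimpleFunc (Rn n) (Rn n)) (h : ℝ) (φ : 𝓓(Ω, ℂ)) :
    averageOp c h (fn (ofTest φ)) =ᵐ[volume.restrict (Ω : Set (Rn n))]
      fun x => ⨍ t in Metric.ball (c x) h, φ t := by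
  have hav : ∀ y, ⟪(indicatorConstLp 2 (measurableSet_ball (x := y) (ε := h))
      (measure_ne_top _ _) ((volume (Metric.ball y h)).toReal⁻¹ : ℂ) : L2 Ω),
      fn (ofTest φ)⟫_ℂ = ⨍ t in Metric.ball y h, φ t := by
    intro y
    rw [L2.inner_indicatorConstLp_eq_inner_setIntegral]
    have h1 : ∫ x in Metric.ball y h, fn (ofTest φ) x ∂(volume.restrict (Ω : Set (Rn n))) =
        ∫ x in Metric.ball y h, φ x := by
      rw [setIntegral_congr_ae (g := φ) measurableSet_ball
        ((fn_ofTest_ae φ).mono fun x hx _ => hx)]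
      rw [Measure.restrict_restrict measurableSet_ball]
      refine (setIntegral_eq_of_subset_of_forall_sdiff_eq_zero measurableSet_ball
        Set.inter_subset_left fun x hx => ?_).symm
      exact image_eq_zero_of_notMem_tsupport
        fun h' => hx.2 ⟨hx.1, φ.tsupport_subset h'⟩
    rw [h1, setAverage_eq]
    simp [Measure.real, mul_comm]
  have hsum : ∀ s : Finset (Rn n), ∀ a : Rn n → ℂ,
      (∑ y ∈ s, a y • (indicatorConstLp 2 (c.measurableSet_fiber y) (measure_ne_top _ _)
        (1 : ℂ) : L2 Ω) : L2 Ω) =ᵐ[volume.restrict (Ω : Set (Rn n))]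
      fun x => ∑ y ∈ s, if c x = y then a y else 0 := by
    intro s a
    have h1 : ∀ y ∈ s, ∀ᵐ x ∂(volume.restrict (Ω : Set (Rn n))),
        (a y • (indicatorConstLp 2 (c.measurableSet_fiber y) (measure_ne_top _ _)
        (1 : ℂ) : L2 Ω) : L2 Ω) x = if c x = y then a y else 0 := by
      intro y _
      filter_upwards [Lp.coeFn_smul (a y) (indicatorConstLp 2 (c.measurableSet_fiber y)
        (measure_ne_top _ _) (1 : ℂ) : L2 Ω), indicatorConstLp_coeFn (p := 2)
        (μ := volume.restrict (Ω : Set (Rn n))) (hs := c.measurableSet_fiber y)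
        (hμs := measure_ne_top _ _) (c := (1 : ℂ))] with x h2 h3
      rw [h2, Pi.smul_apply, h3]
      by_cases hx : c x = y <;> simp [Set.indicator, hx]
    filter_upwards [Lp.coeFn_finsetSum s fun y => a y • (indicatorConstLp 2
      (c.measurableSet_fiber y) (measure_ne_top _ _) (1 : ℂ) : L2 Ω),
      (Finset.eventually_all s).mpr h1] with x h2 h3
    rw [h2, Finset.sum_apply]
    exact Finset.sum_congr rfl h3
  have hP : averageOp c h (fn (ofTest φ)) = ∑ y ∈ c.range, (⨍ t in Metric.ball y h, φ t) •
      (indicatorConstLp 2 (c.measurableSet_fiber y) (measure_ne_top _ _) (1 : ℂ) : L2 Ω) := by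
    simp only [averageOp, _root_.sum_apply, ContinuousLinearMap.smulRight_apply,
      innerSL_apply_apply, hav]
  rw [hP]
  filter_upwards [hsum c.range fun y => ⨍ t in Metric.ball y h, φ t] with x hx
  rw [hx, Finset.sum_ite_eq, if_pos (c.mem_range_self x)]

/-- The average is taken over a ball `B(y, h)` near `x`, which lies in `B(x, 2h)`. -/
lemma enorm_sub_average_sq_le (φ : 𝓓(Ω, ℂ)) {h : ℝ} (hh : 0 < h) {x y : Rn n}
    (hxy : dist x y < h) :
    ‖φ x - ⨍ t in Metric.ball y h, φ t‖ₑ ^ 2 ≤ (volume (Metric.ball (0 : Rn n) h))⁻¹ *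
      ∫⁻ z in Metric.ball (0 : Rn n) (2 * h), ‖φ (x + z) - φ x‖ₑ ^ 2 := by
  set B := volume (Metric.ball (0 : Rn n) h) with hB
  have hB0 : B ≠ 0 := (Metric.measure_ball_pos _ _ hh).ne'
  have hBt : B ≠ ⊤ := measure_ball_lt_top.ne
  have hBy : volume (Metric.ball y h) = B := Measure.addHaar_ball_center _ _ _
  have : IsFiniteMeasure (volume.restrict (Metric.ball y h)) := ⟨by simp [measure_ball_lt_top]⟩
  have hint : Integrable φ (volume.restrict (Metric.ball y h)) :=
    (φ.continuous.integrable_of_hasCompactSupport φ.hasCompactSupport).restrict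
  have h1 : φ x - ⨍ t in Metric.ball y h, φ t = B.toReal⁻¹ •
      ∫ t in Metric.ball y h, (φ x - φ t) := by
    rw [integral_sub (integrable_const _) hint, smul_sub, setAverage_eq, Measure.real, hBy,
      setIntegral_const, Measure.real, hBy, smul_smul, inv_mul_cancel₀, one_smul]
    exact (ENNReal.toReal_pos hB0 hBt).ne'
  have h2 : ‖B.toReal⁻¹‖ₑ = B⁻¹ := by
    rw [Real.enorm_eq_ofReal (by positivity), ENNReal.ofReal_inv_of_pos
      (ENNReal.toReal_pos hB0 hBt), ENNReal.ofReal_toReal hBt]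
  have hm : Continuous fun t => ‖φ x - φ t‖ₑ := (continuous_const.sub φ.continuous).enorm
  calc ‖φ x - ⨍ t in Metric.ball y h, φ t‖ₑ ^ 2
      = B⁻¹ ^ 2 * ‖∫ t in Metric.ball y h, (φ x - φ t)‖ₑ ^ 2 := by
        rw [h1, enorm_smul, h2, mul_pow]
    _ ≤ B⁻¹ ^ 2 * (∫⁻ t in Metric.ball y h, ‖φ x - φ t‖ₑ) ^ 2 := by
        gcongr
        exact enorm_integral_le_lintegral_enorm _
    _ ≤ B⁻¹ ^ 2 * (B * ∫⁻ t in Metric.ball y h, ‖φ x - φ t‖ₑ ^ 2) := by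
        gcongr
        refine (sq_lintegral_le _ hm.measurable.aemeasurable).trans_eq ?_
        rw [Measure.restrict_apply_univ, hBy]
    _ = B⁻¹ * ∫⁻ t in Metric.ball y h, ‖φ x - φ t‖ₑ ^ 2 := by
        rw [pow_two, mul_assoc, ← mul_assoc B⁻¹ B, ENNReal.inv_mul_cancel hB0 hBt, one_mul]
    _ ≤ B⁻¹ * ∫⁻ t in Metric.ball x (2 * h), ‖φ x - φ t‖ₑ ^ 2 := by
        gcongr
        refine Metric.ball_subset_ball' ?_
        rw [dist_comm]
        linarith
    _ = _ := by
        congr 1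
        have h3 := (measurePreserving_add_left (volume : Measure (Rn n)) x).setLIntegral_comp_emb
          (MeasurableEquiv.addLeft x).measurableEmbedding (fun t => ‖φ x - φ t‖ₑ ^ 2)
          (Metric.ball (0 : Rn n) (2 * h))
        have h4 : (fun z => x + z) '' Metric.ball (0 : Rn n) (2 * h) =
            Metric.ball x (2 * h) := by simp
        rw [h4] at h3
        rw [← h3]
        simp only [← enorm_neg (φ x - _), neg_sub]

lemma lintegral_sub_average_sq_le (φ : 𝓓(Ω, ℂ)) {h : ℝ} (hh : 0 < h)
    {c : SimpleFunc (Rn n) (Rn n)} (hc : ∀ x ∈ Ω, dist x (c x) < h) :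
    ∫⁻ x in (Ω : Set (Rn n)), ‖φ x - ⨍ t in Metric.ball (c x) h, φ t‖ₑ ^ 2 ≤
      ENNReal.ofReal (2 ^ n * (2 * h) ^ 2) * ∫⁻ x, ‖classicalGrad φ x‖ₑ ^ 2 := by
  set B := volume (Metric.ball (0 : Rn n) h) with hB
  have hB0 : B ≠ 0 := (Metric.measure_ball_pos _ _ hh).ne'
  have hBt : B ≠ ⊤ := measure_ball_lt_top.ne
  have hcont : Continuous fun p : Rn n × Rn n => ‖φ (p.1 + p.2) - φ p.1‖ₑ ^ 2 :=
    (ENNReal.continuous_pow 2).comp ((φ.continuous.comp (by fun_prop)).sub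
      (φ.continuous.comp continuous_fst)).enorm
  have hB2 : volume (Metric.ball (0 : Rn n) (2 * h)) = ENNReal.ofReal (2 ^ n) * B := by
    rw [Measure.addHaar_ball_mul_of_pos _ _ (by norm_num)]
    simp [hB]
  calc ∫⁻ x in (Ω : Set (Rn n)), ‖φ x - ⨍ t in Metric.ball (c x) h, φ t‖ₑ ^ 2
      ≤ ∫⁻ x in (Ω : Set (Rn n)), B⁻¹ *
          ∫⁻ z in Metric.ball (0 : Rn n) (2 * h), ‖φ (x + z) - φ x‖ₑ ^ 2 :=
        setLIntegral_mono' Ω.isOpen.measurableSet fun x hx =>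
          enorm_sub_average_sq_le φ hh (hc x hx)
    _ ≤ ∫⁻ x, B⁻¹ * ∫⁻ z in Metric.ball (0 : Rn n) (2 * h), ‖φ (x + z) - φ x‖ₑ ^ 2 :=
        setLIntegral_le_lintegral _ _
    _ = B⁻¹ * ∫⁻ z in Metric.ball (0 : Rn n) (2 * h), ∫⁻ x, ‖φ (x + z) - φ x‖ₑ ^ 2 := by
        rw [lintegral_const_mul' _ _ (ENNReal.inv_ne_top.mpr hB0),
          lintegral_lintegral_swap hcont.measurable.aemeasurable]
    _ ≤ B⁻¹ * ∫⁻ _ in Metric.ball (0 : Rn n) (2 * h),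
          ENNReal.ofReal ((2 * h) ^ 2) * ∫⁻ x, ‖classicalGrad φ x‖ₑ ^ 2 := by
        refine mul_le_mul' le_rfl (setLIntegral_mono' measurableSet_ball fun z hz => ?_)
        refine (lintegral_translate_sub_le φ z).trans ?_
        gcongr
        rw [← ofReal_norm, ← ENNReal.ofReal_pow (norm_nonneg _)]
        refine ENNReal.ofReal_le_ofReal ?_
        gcongr
        exact (mem_ball_zero_iff.mp hz).le
    _ = B⁻¹ * (ENNReal.ofReal ((2 * h) ^ 2) * (∫⁻ x, ‖classicalGrad φ x‖ₑ ^ 2) *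
          (ENNReal.ofReal (2 ^ n) * B)) := by
        rw [setLIntegral_const, hB2]
    _ = (B⁻¹ * B) * (ENNReal.ofReal (2 ^ n) * ENNReal.ofReal ((2 * h) ^ 2)) *
          ∫⁻ x, ‖classicalGrad φ x‖ₑ ^ 2 := by ring
    _ = _ := by
        rw [ENNReal.inv_mul_cancel hB0 hBt, one_mul, ← ENNReal.ofReal_mul (by positivity)]

/-- On `H¹₀(Ω)` the averages over balls of radius `h` approximate the identity at rate `O(h)`.
The factor `2 ^ n` is `|B(2h)| / |B(h)|`, up to a square root that is not needed. -/
lemma norm_fn_sub_averageOp_le [IsFiniteMeasure (volume.restrict (Ω : Set (Rn n)))] {h : ℝ}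
    (hh : 0 < h)
    {c : SimpleFunc (Rn n) (Rn n)} (hc : ∀ x ∈ Ω, dist x (c x) < h) (u : H10 Ω) :
    ‖fn u - averageOp c h (fn u)‖ ≤ 2 ^ n * (2 * h) * ‖grad u‖ := by
  refine denseRange_ofTest.induction_on
    (p := fun u => ‖fn u - averageOp c h (fn u)‖ ≤ 2 ^ n * (2 * h) * ‖grad u‖) u ?_ ?_
  · exact isClosed_le (fnL.continuous.sub ((averageOp c h).continuous.comp fnL.continuous)).norm
      (continuous_const.mul gradL.continuous.norm)
  intro φ
  have h1 : ‖fn (ofTest φ) - averageOp c h (fn (ofTest φ))‖ₑ ^ 2 ≤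
      ENNReal.ofReal (2 ^ n * (2 * h) ^ 2) * ‖grad (ofTest φ)‖ₑ ^ 2 := by
    rw [enorm_sq_grad_ofTest, enorm_sq_eq_lintegral]
    refine le_trans (le_of_eq ?_) (lintegral_sub_average_sq_le φ hh hc)
    refine lintegral_congr_ae ?_
    filter_upwards [Lp.coeFn_sub (fn (ofTest φ)) (averageOp c h (fn (ofTest φ))),
      fn_ofTest_ae φ, averageOp_ofTest_ae c h φ] with x h1 h2 h3
    rw [h1, Pi.sub_apply, h2, h3]
  have h2 : ‖fn (ofTest φ) - averageOp c h (fn (ofTest φ))‖ ^ 2 ≤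
      2 ^ n * (2 * h) ^ 2 * ‖grad (ofTest φ)‖ ^ 2 := by
    rw [← ofReal_norm, ← ofReal_norm, ← ENNReal.ofReal_pow (norm_nonneg _),
      ← ENNReal.ofReal_pow (norm_nonneg _), ← ENNReal.ofReal_mul (by positivity)] at h1
    exact (ENNReal.ofReal_le_ofReal_iff (by positivity)).mp h1
  refine (sq_le_sq₀ (norm_nonneg _) (by positivity)).mp (h2.trans ?_)
  have h3 : (1 : ℝ) ≤ 2 ^ n := one_le_pow₀ (by norm_num)
  have h4 : (2 : ℝ) ^ n ≤ (2 ^ n) ^ 2 := by nlinarith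
  calc 2 ^ n * (2 * h) ^ 2 * ‖grad (ofTest φ)‖ ^ 2
      ≤ (2 ^ n) ^ 2 * (2 * h) ^ 2 * ‖grad (ofTest φ)‖ ^ 2 := by gcongr
    _ = _ := by ring

/-- **Rellich's theorem**: the embedding `H¹₀(Ω) → L²(Ω)` is compact for bounded `Ω`. -/
theorem isCompactOperator_fnL (hbdd : Bornology.IsBounded (Ω : Set (Rn n))) :
    IsCompactOperator (fnL : H10 Ω →L[ℂ] L2 Ω) := by
  have : IsFiniteMeasure (volume.restrict (Ω : Set (Rn n))) :=
    ⟨by simpa using hbdd.measure_lt_top⟩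
  have hpos : ∀ k : ℕ, (0 : ℝ) < 1 / (k + 1) := fun k => by positivity
  choose c hc using fun k : ℕ => exists_simpleFunc_dist_lt hbdd (hpos k)
  refine isCompactOperator_of_tendsto (l := atTop)
    (F := fun k : ℕ => (averageOp (c k) (1 / (k + 1))).comp (fnL : H10 Ω →L[ℂ] L2 Ω)) ?_ ?_
  · refine (tendsto_iff_norm_sub_tendsto_zero (E := H10 Ω →L[ℂ] L2 Ω)).mpr ?_
    refine squeeze_zero (g := fun k : ℕ => 2 ^ n * (2 * (1 / ((k : ℝ) + 1))))
      (fun _ => ContinuousLinearMap.opNorm_nonneg _) (fun k => ?_) ?_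
    · refine ContinuousLinearMap.opNorm_le_bound _ (by positivity) fun u => ?_
      rw [_root_.sub_apply, norm_sub_rev]
      refine (norm_fn_sub_averageOp_le (hpos k) (hc k) u).trans ?_
      gcongr
      refine (sq_le_sq₀ (norm_nonneg _) (norm_nonneg _)).mp ?_
      rw [norm_sq_H10]
      exact le_add_of_nonneg_left (sq_nonneg _)
    · simpa using (tendsto_one_div_add_atTop_nhds_zero_nat (𝕜 := ℝ)).const_mul (2 ^ n * 2)
        |>.congr fun k => by ring
  · exact Eventually.of_forall fun k => (isCompactOperator_averageOp (c k) _).comp_clm _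

/-! ### Eigenvalues of compact symmetric operators -/

/-- Eigenvalues of a compact symmetric operator accumulate only at `0`. -/
lemma finite_eigenvalues_ge {H : Type*} [NormedAddCommGroup H] [InnerProductSpace ℂ H]
    {T : H →L[ℂ] H} (hT : IsCompactOperator T) (hsymm : (T : H →ₗ[ℂ] H).IsSymmetric) {r : ℝ}
    (hr : 0 < r) : {μ : ℝ | r ≤ μ ∧ Module.End.HasEigenvalue (T : H →ₗ[ℂ] H) (μ : ℂ)}.Finite := by
  by_contra hinf
  have hinf' : Set.Infinite
    {μ : ℝ | r ≤ μ ∧ Module.End.HasEigenvalue (T : H →ₗ[ℂ] H) (μ : ℂ)} := hinf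
  have hex : ∀ k : ℕ, ∃ e : H, ‖e‖ = 1 ∧ T e = ((hinf'.natEmbedding _ k : ℝ) : ℂ) • e := by
    intro k
    obtain ⟨v, hv⟩ := (hinf'.natEmbedding _ k).2.2.exists_hasEigenvector
    have hv0 : (‖v‖ : ℂ) ≠ 0 := by simpa using hv.2
    refine ⟨(‖v‖ : ℂ)⁻¹ • v, ?_, ?_⟩
    · rw [norm_smul, norm_inv, Complex.norm_real, norm_norm]
      exact inv_mul_cancel₀ (by simpa using hv.2)
    · rw [map_smul, smul_comm]
      congr 1
      exact hv.apply_eq_smul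
  choose e he1 heT using hex
  set m : ℕ → ℝ := fun k => (hinf'.natEmbedding _ k : ℝ) with hm
  have hmr : ∀ k, r ≤ m k := fun k => (hinf'.natEmbedding _ k).2.1
  have horth : ∀ k l, k ≠ l → ⟪e k, e l⟫_ℂ = 0 := by
    intro k l hkl
    have h1 := hsymm (e k) (e l)
    simp only [ContinuousLinearMap.coe_coe, heT, inner_smul_left, inner_smul_right,
      Complex.conj_ofReal] at h1
    have h2 : ((m k : ℂ) - m l) * ⟪e k, e l⟫_ℂ = 0 := by
      rw [sub_mul, sub_eq_zero]
      exact h1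
    refine (mul_eq_zero.mp h2).resolve_left fun h3 => hkl ?_
    have h4 : m k = m l := by exact_mod_cast sub_eq_zero.mp h3
    exact (hinf'.natEmbedding _).injective (Subtype.ext h4)
  obtain ⟨K, hK, hKsub⟩ := hT.image_closedBall_subset_compact (f := (T : H →ₗ[ℂ] H)) 1
  have hmem : ∀ k, T (e k) ∈ K := fun k =>
    hKsub ⟨e k, by simp [he1 k], rfl⟩
  obtain ⟨a, _, φ, hφ, hlim⟩ := hK.tendsto_subseq hmem
  have hcau := hlim.cauchySeq
  rw [Metric.cauchySeq_iff'] at hcau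
  obtain ⟨N, hN⟩ := hcau r hr
  have h5 := hN (N + 1) (Nat.le_succ N)
  have hne : φ (N + 1) ≠ φ N := fun h => absurd (hφ.injective h) (Nat.succ_ne_self N)
  -- the images of two distinct unit eigenvectors are at distance at least `r`
  have h6 : ‖T (e (φ (N + 1))) - T (e (φ N))‖ ^ 2 = m (φ (N + 1)) ^ 2 + m (φ N) ^ 2 := by
    rw [heT, heT, @norm_sub_sq ℂ, inner_smul_left, inner_smul_right, horth _ _ hne]
    simp [norm_smul, he1, hm]
  have h7 : ‖T (e (φ (N + 1))) - T (e (φ N))‖ < r := by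
    simpa [dist_eq_norm] using h5
  have h8 := hmr (φ (N + 1))
  have h9 := norm_nonneg (T (e (φ (N + 1))) - T (e (φ N)))
  nlinarith [sq_nonneg (m (φ N))]

/-- A locally finite multiset of reals that is bounded below and infinite, given by its
multiplicity function `m`, can be listed in increasing order. -/
lemma exists_monotone_enumeration (m : ℝ → ℕ) (hfin : ∀ R, {x | m x ≠ 0 ∧ x ≤ R}.Finite)
    (hinf : {x | m x ≠ 0}.Infinite) :
    ∃ lam : ℕ → ℝ, Monotone lam ∧ Tendsto lam atTop atTop ∧
      ∀ x, {k | lam k = x}.ncard = m x := by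
  -- the pairs `(x, j)` with `j < m x`, in lexicographic order, have finite initial segments
  let X := {p : ℝ ×ₗ ℕ // (ofLex p).2 < m (ofLex p).1}
  have hle : ∀ p q : X, p ≤ q → (ofLex p.1).1 ≤ (ofLex q.1).1 := fun p q h => by
    rcases Prod.Lex.le_iff.mp (show p.1 ≤ q.1 from h) with h | h
    · exact h.le
    · exact h.1.le
  have hfinX : ∀ R, {p : X | (ofLex p.1).1 ≤ R}.Finite := by
    intro R
    refine Set.Finite.of_finite_image (f := fun p : X => ofLex p.1) ?_ ?_
    · refine ((hfin R).biUnion fun x _ => ((Set.finite_Iio (m x)).image fun j => (x, j))).subset ?_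
      rintro _ ⟨p, hp, rfl⟩
      have h1 := p.2
      refine Set.mem_biUnion (x := (ofLex p.1).1) ⟨by omega, hp⟩ ⟨(ofLex p.1).2, h1, rfl⟩
    · exact fun p _ q _ h => Subtype.ext (ofLex.injective h)
  have hIic : ∀ q : X, (Set.Iic q).Finite := fun q =>
    (hfinX (ofLex q.1).1).subset fun p hp => hle p q hp
  have hinfX : Infinite X := by
    have : Infinite {x // m x ≠ 0} := hinf.to_subtype
    refine Infinite.of_surjective
      (fun p : X => (⟨(ofLex p.1).1, by have := p.2; omega⟩ : {x // m x ≠ 0})) ?_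
    rintro ⟨x, hx⟩
    exact ⟨⟨toLex (x, 0), Nat.pos_of_ne_zero hx⟩, rfl⟩
  let _ : LocallyFiniteOrder X :=
    LocallyFiniteOrder.ofFiniteIcc fun a b => (hIic b).subset Set.Icc_subset_Iic_self
  obtain ⟨b, hb⟩ : ∃ b : X, ∀ q, b ≤ q := by
    obtain ⟨a⟩ : Nonempty X := inferInstance
    obtain ⟨b, hb, hmin⟩ := (hIic a).exists_minimal ⟨a, Set.mem_Iic.mpr le_rfl⟩
    refine ⟨b, fun q => ?_⟩
    rcases le_total b q with h | h
    · exact h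
    · exact hmin (Set.mem_Iic.mpr (h.trans hb)) h
  let _ : OrderBot X := { bot := b, bot_le := hb }
  have : NoMaxOrder X := ⟨fun a => by
    by_contra! h
    exact Set.infinite_univ ((hIic a).subset fun x _ => Set.mem_Iic.mpr (not_lt.mp (h x)))⟩
  let _ : SuccOrder X := LinearLocallyFiniteOrder.succOrder X
  let _ : PredOrder X := LinearLocallyFiniteOrder.predOrder X
  let e : X ≃o ℕ := orderIsoNatOfLinearSuccPredArch
  have hmono : Monotone fun k => (ofLex (e.symm k).1).1 :=
    fun a b hab => hle _ _ (e.symm.monotone hab)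
  refine ⟨fun k => (ofLex (e.symm k).1).1, hmono, ?_, fun x => ?_⟩
  · refine tendsto_atTop_atTop_of_monotone hmono fun R => ?_
    by_contra! h
    refine Set.infinite_univ (α := ℕ) ?_
    refine ((hfinX R).image e).subset fun k _ => ⟨e.symm k, (h k).le, e.apply_symm_apply k⟩
  · have h1 : {k | (ofLex (e.symm k).1).1 = x} =
        Set.range fun j : Fin (m x) => e ⟨toLex (x, j.1), j.2⟩ := by
      ext k
      constructor
      · rintro rfl
        exact ⟨⟨_, (e.symm k).2⟩, e.apply_symm_apply k⟩
      · rintro ⟨j, rfl⟩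
        simp
    rw [h1, ← Set.image_univ, Set.ncard_image_of_injective, Set.ncard_univ, Nat.card_fin]
    intro i j hij
    have := congrArg (fun p : X => (ofLex p.1).2) (e.injective hij)
    exact Fin.ext this

/-! ### The Dirichlet Laplacian -/

variable (Ω) in
/-- The compact operator `S` on `H¹₀(Ω)` given by `⟨v, S u⟩_{H¹} = (v, u)_{L²}`, that is
`S = (1 - Δ)⁻¹` with Dirichlet conditions. -/
def resolventOp : H10 Ω →L[ℂ] H10 Ω := (fnL (Ω := Ω)).adjoint.comp fnL

lemma inner_resolventOp (v u : H10 Ω) : ⟪v, resolventOp Ω u⟫_ℂ = ⟪fn v, fn u⟫_ℂ := by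
  simp [resolventOp, ContinuousLinearMap.adjoint_inner_right]

lemma isSymmetric_resolventOp : (resolventOp Ω : H10 Ω →ₗ[ℂ] H10 Ω).IsSymmetric := by
  intro u v
  rw [← inner_conj_symm]
  simp only [ContinuousLinearMap.coe_coe, inner_resolventOp, inner_conj_symm]

lemma isCompactOperator_resolventOp (hbdd : Bornology.IsBounded (Ω : Set (Rn n))) :
    IsCompactOperator (resolventOp Ω) :=
  (isCompactOperator_fnL hbdd).clm_comp (fnL (Ω := Ω)).adjoint

/-- `u` is a weak solution of `-Δu = z u` in `H¹₀(Ω)`. -/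
def IsDirichlet (z : ℂ) (u : H10 Ω) : Prop :=
  ∀ v : H10 Ω, ⟪grad v, grad u⟫_ℂ = z * ⟪fn v, fn u⟫_ℂ

/-- `-Δu = z u` is the eigenvalue equation `S u = (1 + z)⁻¹ u`. For `z = -1` both sides say
`u = 0`, since `S` is injective and `0⁻¹ = 0`. -/
lemma isDirichlet_iff {z : ℂ} {u : H10 Ω} :
    IsDirichlet z u ↔
      u ∈ Module.End.eigenspace (resolventOp Ω : H10 Ω →ₗ[ℂ] H10 Ω) (1 + z)⁻¹ := by
  have h1 : IsDirichlet z u ↔ u = (1 + z) • resolventOp Ω u := by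
    have h2 : ∀ v : H10 Ω, ⟪v, (1 + z) • resolventOp Ω u⟫_ℂ =
        ⟪fn v, fn u⟫_ℂ + z * ⟪fn v, fn u⟫_ℂ := fun v => by
      refine (inner_smul_right v _ (1 + z)).trans ?_
      rw [inner_resolventOp]
      ring
    constructor
    · intro h
      refine ext_inner_left ℂ fun v => ?_
      rw [h2, inner_H10, h v]
    · intro h v
      have h3 := congrArg (fun w => ⟪v, w⟫_ℂ) h
      simp only [h2, inner_H10] at h3
      exact add_left_cancel h3
  rw [h1, Module.End.mem_eigenspace_iff]
  simp only [ContinuousLinearMap.coe_coe]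
  by_cases hz : 1 + z = 0
  · rw [hz, zero_smul, inv_zero, zero_smul]
    constructor
    · rintro rfl
      simp
    · intro h
      have h3 := inner_resolventOp u u
      rw [h, inner_zero_right] at h3
      exact fn_eq_zero_iff.mp (inner_self_eq_zero.mp h3.symm)
  · constructor
    · intro h
      conv_rhs => rw [h]
      rw [smul_smul, inv_mul_cancel₀ hz, one_smul]
    · intro h
      rw [h, smul_smul, mul_inv_cancel₀ hz, one_smul]

lemma IsDirichlet.norm_sq {z : ℂ} {u : H10 Ω} (h : IsDirichlet z u) :
    (‖grad u‖ ^ 2 : ℂ) = z * (‖fn u‖ ^ 2 : ℂ) := by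
  have := h u
  rwa [inner_self_eq_norm_sq_to_K, inner_self_eq_norm_sq_to_K] at this

/-- Dirichlet eigenvalues are real and positive. -/
lemma IsDirichlet.exists_real (hn : 1 ≤ n) (hbdd : Bornology.IsBounded (Ω : Set (Rn n)))
    {z : ℂ} {u : H10 Ω} (h : IsDirichlet z u) (hu : u ≠ 0) : ∃ x : ℝ, 0 < x ∧ z = x := by
  obtain ⟨C, hC, hP⟩ := exists_poincare hn hbdd
  have h0 : 0 < ‖fn u‖ := norm_pos_iff.mpr fun h' => hu (fn_eq_zero_iff.mp h')
  have h1 : 0 < ‖grad u‖ := by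
    rcases (norm_nonneg (grad u)).eq_or_lt with h' | h'
    · have := hP u
      rw [← h', mul_zero] at this
      exact absurd h0 (not_lt.mpr this)
    · exact h'
  refine ⟨‖grad u‖ ^ 2 / ‖fn u‖ ^ 2, by positivity, ?_⟩
  have h2 : (‖fn u‖ : ℂ) ≠ 0 := by exact_mod_cast h0.ne'
  push_cast
  rw [eq_div_iff (pow_ne_zero 2 h2), h.norm_sq]

lemma eq_zero_of_resolventOp_eq_zero {u : H10 Ω} (h : resolventOp Ω u = 0) : u = 0 := by
  have h3 := inner_resolventOp u u
  rw [h, inner_zero_right] at h3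
  exact fn_eq_zero_iff.mp (inner_self_eq_zero.mp h3.symm)

lemma isDirichlet_of_mem_eigenspace {μ : ℂ} {u : H10 Ω}
    (h : u ∈ Module.End.eigenspace (resolventOp Ω : H10 Ω →ₗ[ℂ] H10 Ω) μ) :
    IsDirichlet (μ⁻¹ - 1) u := by
  rw [isDirichlet_iff]
  simpa using h

/-- The Dirichlet eigenfunctions are complete in `H¹₀(Ω)`. -/
lemma eq_zero_of_orthogonal_dirichlet (hbdd : Bornology.IsBounded (Ω : Set (Rn n))) {w : H10 Ω}
    (h : ∀ (z : ℂ) (u : H10 Ω), u ≠ 0 → IsDirichlet z u → ⟪u, w⟫_ℂ = 0) : w = 0 := by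
  have h1 := ContinuousLinearMap.orthogonalComplement_iSup_eigenspaces_eq_bot
    (isCompactOperator_resolventOp hbdd) isSymmetric_resolventOp
  rw [← Submodule.mem_bot ℂ, ← h1, Submodule.mem_orthogonal]
  intro u hu
  induction hu using Submodule.iSup_induction' with
  | mem μ u hu =>
    by_cases h0 : u = 0
    · rw [h0, inner_zero_left]
    · exact h _ u h0 (isDirichlet_of_mem_eigenspace hu)
  | zero => exact inner_zero_left _
  | add u v _ _ hu hv => rw [inner_add_left, hu, hv, add_zero]

/-- The Dirichlet eigenfunctions are complete in `L²(Ω)`. -/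
lemma L2_eq_zero_of_orthogonal_dirichlet (hbdd : Bornology.IsBounded (Ω : Set (Rn n))) {d : L2 Ω}
    (h : ∀ (z : ℂ) (u : H10 Ω), u ≠ 0 → IsDirichlet z u → ⟪fn u, d⟫_ℂ = 0) : d = 0 := by
  have h1 : (fnL (Ω := Ω)).adjoint d = 0 :=
    eq_zero_of_orthogonal_dirichlet hbdd fun z u hu hz => by
      rw [ContinuousLinearMap.adjoint_inner_right]
      exact h z u hu hz
  have h2 : d =ᵐ[volume.restrict (Ω : Set (Rn n))] (0 : Rn n → ℂ) := by
    refine ae_eq_zero_of_integral_test (Lp.memLp d) fun φ => ?_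
    have h3 := ContinuousLinearMap.adjoint_inner_right (fnL (Ω := Ω)) (ofTest (conjTest φ)) d
    have h4 : conjTest (conjTest φ) = φ := by ext x; simp
    rw [h1, inner_zero_right, fnL_apply, inner_fn_ofTest, h4] at h3
    exact h3.symm
  exact Lp.ext (h2.trans (Lp.coeFn_zero _ _ _).symm)

/-! ### The least-squares eigenproblem is the Dirichlet eigenproblem -/

lemma IsDirichlet.hasWeakDiv {z : ℂ} {u : H10 Ω} (h : IsDirichlet z u) :
    HasWeakDiv (grad u) (-(z • fn u)) := by
  rw [hasWeakDiv_iff]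
  intro v
  rw [h v, inner_neg_right, neg_neg, inner_smul_right]

/-- In a solution the flux is the gradient: by the second equation `σ - ∇u` is divergence-free, and
then the first equation, tested with `σ - ∇u`, gives `‖σ - ∇u‖² = 0`. -/
lemma SolvesF1.vec_eq_grad {z : ℂ} {σ : Hdiv Ω} {u : H10 Ω} (h : SolvesF1 z σ u) :
    vec σ = grad u := by
  have h1 : ∀ v : H10 Ω, ⟪grad v, vec σ - grad u⟫_ℂ = 0 := fun v => by
    have := h.potential v
    simp only [ip] at this
    rw [inner_sub_right]
    linear_combination -this
  have h2 : HasWeakDiv (vec σ - grad u) 0 := by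
    rw [hasWeakDiv_iff]
    intro v
    rw [h1, inner_zero_right, neg_zero]
  have h3 : ⟪vec σ - grad u, vec σ⟫_ℂ + ⟪(0 : L2 Ω), div σ⟫_ℂ - ⟪vec σ - grad u, grad u⟫_ℂ =
      -z * ⟪(0 : L2 Ω), fn u⟫_ℂ := h.flux ⟨WithLp.toLp 2 (vec σ - grad u, 0), h2⟩
  simp only [inner_zero_left, add_zero, mul_zero] at h3
  have h4 : ⟪vec σ - grad u, vec σ - grad u⟫_ℂ = 0 := by
    rw [inner_sub_right]
    exact h3
  exact sub_eq_zero.mp (inner_self_eq_zero.mp h4)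

/-- The least-squares eigenproblem has the same eigenpairs as the Dirichlet Laplacian. -/
lemma mem_eigenspace_iff (hn : 1 ≤ n) (hbdd : Bornology.IsBounded (Ω : Set (Rn n))) {z : ℂ}
    {u : H10 Ω} : u ∈ eigenspace Ω z ↔ IsDirichlet z u := by
  constructor
  · rintro ⟨σ, hσ⟩
    have h1 := hσ.vec_eq_grad
    -- `div σ + z u` is orthogonal to `div ∇e = -x e` for every Dirichlet eigenfunction `e`
    have h2 : div σ + z • fn u = 0 := by
      refine L2_eq_zero_of_orthogonal_dirichlet hbdd fun z' e he hz' => ?_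
      obtain ⟨x, hx, rfl⟩ := hz'.exists_real hn hbdd he
      have h3 : ⟪grad e, vec σ⟫_ℂ + ⟪-((x : ℂ) • fn e), div σ⟫_ℂ - ⟪grad e, grad u⟫_ℂ =
          -z * ⟪-((x : ℂ) • fn e), fn u⟫_ℂ :=
        hσ.flux ⟨WithLp.toLp 2 (grad e, -((x : ℂ) • fn e)), hz'.hasWeakDiv⟩
      rw [h1, add_sub_cancel_left] at h3
      have h4 : ⟪-((x : ℂ) • fn e), div σ + z • fn u⟫_ℂ = 0 := by
        rw [inner_add_right, inner_smul_right]
        linear_combination h3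
      rw [inner_neg_left, inner_smul_left, neg_eq_zero] at h4
      refine (mul_eq_zero.mp h4).resolve_left ?_
      simpa using hx.ne'
    have h5 : HasWeakDiv (grad u) (div σ) := h1 ▸ σ.2
    intro v
    rw [hasWeakDiv_iff.mp h5 v, eq_neg_of_add_eq_zero_left h2, inner_neg_right, neg_neg,
      inner_smul_right]
  · intro h
    refine ⟨⟨WithLp.toLp 2 (grad u, -(z • fn u)), h.hasWeakDiv⟩, fun τ => ?_, fun v => ?_⟩
    · change ⟪vec τ, grad u⟫_ℂ + ⟪div τ, -(z • fn u)⟫_ℂ - ⟪vec τ, grad u⟫_ℂ =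
        -z * ⟪div τ, fn u⟫_ℂ
      rw [inner_neg_right, inner_smul_right]
      ring
    · simp [ip, vec]

lemma eigenspace_eq (hn : 1 ≤ n) (hbdd : Bornology.IsBounded (Ω : Set (Rn n))) (z : ℂ) :
    eigenspace Ω z =
      Module.End.eigenspace (resolventOp Ω : H10 Ω →ₗ[ℂ] H10 Ω) (1 + z)⁻¹ := by
  ext u
  rw [mem_eigenspace_iff hn hbdd, isDirichlet_iff]

lemma isEigenvalue_iff (hn : 1 ≤ n) (hbdd : Bornology.IsBounded (Ω : Set (Rn n))) {z : ℂ} :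
    IsEigenvalue Ω z ↔ ∃ x : ℝ, 0 < x ∧ z = x ∧ eigenspace Ω (x : ℂ) ≠ ⊥ := by
  constructor
  · rintro ⟨u, hu, hσ⟩
    have hu0 : u ≠ 0 := fun h => hu (fn_eq_zero_iff.mpr h)
    have hmem : u ∈ eigenspace Ω z := hσ
    obtain ⟨x, hx, rfl⟩ := ((mem_eigenspace_iff hn hbdd).mp hmem).exists_real hn hbdd hu0
    exact ⟨x, hx, rfl, fun h => hu0 ((Submodule.eq_bot_iff _).mp h u hmem)⟩
  · rintro ⟨x, _, rfl, h⟩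
    obtain ⟨u, hu, hu0⟩ := Submodule.exists_mem_ne_zero_of_ne_bot h
    exact ⟨u, fun h' => hu0 (fn_eq_zero_iff.mp h'), hu⟩

/-! ### The Dirichlet spectrum -/

lemma finiteDimensional_eigenspace (hn : 1 ≤ n) (hbdd : Bornology.IsBounded (Ω : Set (Rn n)))
    (z : ℂ) : FiniteDimensional ℂ (eigenspace Ω z) := by
  by_cases hz : 1 + z = 0
  · have : eigenspace Ω z = ⊥ := by
      rw [eigenspace_eq hn hbdd, hz, inv_zero, Submodule.eq_bot_iff]
      intro u hu
      rw [Module.End.mem_eigenspace_iff, zero_smul] at hu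
      exact eq_zero_of_resolventOp_eq_zero hu
    rw [this]
    infer_instance
  · rw [eigenspace_eq hn hbdd]
    exact ContinuousLinearMap.finite_dimensional_eigenspace
      (isCompactOperator_resolventOp hbdd) _ (inv_ne_zero hz)

lemma pos_of_eigenspace_ne_bot (hn : 1 ≤ n) (hbdd : Bornology.IsBounded (Ω : Set (Rn n))) {x : ℝ}
    (h : eigenspace Ω (x : ℂ) ≠ ⊥) : 0 < x := by
  obtain ⟨u, hu, hu0⟩ := Submodule.exists_mem_ne_zero_of_ne_bot h
  obtain ⟨y, hy, hxy⟩ := ((mem_eigenspace_iff hn hbdd).mp hu).exists_real hn hbdd hu0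
  rwa [Complex.ofReal_injective hxy]

lemma finite_eigenvalues_le (hn : 1 ≤ n) (hbdd : Bornology.IsBounded (Ω : Set (Rn n))) (R : ℝ) :
    {x : ℝ | eigenspace Ω (x : ℂ) ≠ ⊥ ∧ x ≤ R}.Finite := by
  have h1 := finite_eigenvalues_ge (isCompactOperator_resolventOp hbdd) isSymmetric_resolventOp
    (r := (1 + |R|)⁻¹) (by positivity)
  refine Set.Finite.of_finite_image (f := fun x : ℝ => (1 + x)⁻¹) (h1.subset ?_) ?_
  · rintro _ ⟨x, ⟨hx, hxR⟩, rfl⟩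
    have hx0 := pos_of_eigenspace_ne_bot hn hbdd hx
    constructor
    · have := le_abs_self R
      simp only
      gcongr
      linarith
    · rw [eigenspace_eq hn hbdd] at hx
      simpa [Module.End.hasEigenvalue_iff] using hx
  · intro x _ y _ hxy
    simpa using hxy

/-- `H¹₀(Ω)` contains the powers of a bump function, and these are linearly independent: a linear
relation is a polynomial that vanishes on the range of the bump function, which contains
`[0, 1]`. -/
lemma not_finiteDimensional_H10 (hn : 1 ≤ n) (hne : (Ω : Set (Rn n)).Nonempty) :
    ¬ FiniteDimensional ℂ (H10 Ω) := by
  intro hfd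
  obtain ⟨x₀, hx₀⟩ := hne
  obtain ⟨f, hfs, hfc, hfd', -, hf1⟩ := exists_contDiff_tsupport_subset (n := ⊤)
    (Ω.isOpen.mem_nhds hx₀)
  let φ : 𝓓(Ω, ℝ) := ⟨f, hfd', hfc, hfs⟩
  let ψ : ℕ → 𝓓(Ω, ℂ) := fun k => ofRealTest
    (postcomp (fun t : ℝ => t ^ (k + 1)) (contDiff_id.pow _) (by simp) φ)
  have hψ : ∀ k x, ψ k x = (f x : ℂ) ^ (k + 1) := fun k x => by simp [ψ, φ]
  have hrange : Set.Icc 0 1 ⊆ Set.range f := by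
    have hzero : ∃ x, f x = 0 := by
      have : Nonempty (Fin n) := ⟨⟨0, hn⟩⟩
      by_contra! h
      have h2 : tsupport f = Set.univ :=
        Set.eq_univ_of_univ_subset fun x _ => subset_tsupport f (h x)
      exact noncompact_univ (Rn n) (h2 ▸ hfc)
    obtain ⟨y, hy⟩ := hzero
    exact fun t ht => mem_range_of_exists_le_of_exists_ge hfd'.continuous
      ⟨y, hy ▸ ht.1⟩ ⟨x₀, hf1 ▸ ht.2⟩
  have hli : LinearIndependent ℂ fun k => ofTest (ψ k) := by
    rw [linearIndependent_iff']
    intro s g hg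
    set p : Polynomial ℂ := ∑ k ∈ s, Polynomial.monomial (k + 1) (g k) with hp
    have h1 : ∑ k ∈ s, g k • fn (ofTest (ψ k)) = 0 := by
      have := congrArg (fnL (Ω := Ω)) hg
      rw [map_zero, map_sum] at this
      simpa only [map_smul, fnL_apply] using this
    have h2 : ∀ᵐ x ∂(volume.restrict (Ω : Set (Rn n))), p.eval (f x : ℂ) = 0 := by
      have h3 : ∀ k ∈ s, ∀ᵐ x ∂(volume.restrict (Ω : Set (Rn n))),
          (g k • fn (ofTest (ψ k)) : L2 Ω) x = g k * (f x : ℂ) ^ (k + 1) := fun k _ => by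
        filter_upwards [Lp.coeFn_smul (g k) (fn (ofTest (ψ k))), fn_ofTest_ae (ψ k)] with x h4 h5
        rw [h4, Pi.smul_apply, h5, hψ, smul_eq_mul]
      filter_upwards [(Finset.eventually_all s).mpr h3,
        Lp.coeFn_finsetSum s fun k => g k • fn (ofTest (ψ k)),
        Lp.coeFn_zero ℂ 2 (volume.restrict (Ω : Set (Rn n)))] with x h4 h5 h6
      rw [h1, h6, Finset.sum_apply, Finset.sum_congr rfl h4] at h5
      simpa [hp, Polynomial.eval_finsetSum] using h5.symm
    have hcont : Continuous fun x => p.eval (f x : ℂ) :=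
      p.continuous.comp (Complex.continuous_ofReal.comp hfd'.continuous)
    have h3 : Set.EqOn (fun x => p.eval (f x : ℂ)) (fun _ => 0) (Ω : Set (Rn n)) :=
      Measure.eqOn_open_of_ae_eq h2 Ω.isOpen hcont.continuousOn continuousOn_const
    have h4 : ∀ t ∈ Set.Ioc (0 : ℝ) 1, p.eval (t : ℂ) = 0 := by
      intro t ht
      obtain ⟨x, rfl⟩ := hrange ⟨ht.1.le, ht.2⟩
      exact h3 (hfs (subset_tsupport f ht.1.ne'))
    have h5 : p = 0 := by
      refine Polynomial.eq_zero_of_infinite_isRoot p ?_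
      refine ((Set.Ioc_infinite (zero_lt_one' ℝ)).image
        Complex.ofReal_injective.injOn).mono ?_
      rintro _ ⟨t, ht, rfl⟩
      exact h4 t ht
    intro k hk
    have h6 := congrArg (fun q : Polynomial ℂ => q.coeff (k + 1)) h5
    simpa [hp, Polynomial.finsetSum_coeff, Polynomial.coeff_monomial, hk] using h6
  exact not_finite_iff_infinite.mpr (inferInstance : Infinite ℕ) hli.finite

/-- If there were finitely many eigenvalues, the finite-dimensional eigenspaces would span the
whole of `H¹₀(Ω)`. -/
lemma infinite_eigenvalues (hn : 1 ≤ n) (hne : (Ω : Set (Rn n)).Nonempty)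
    (hbdd : Bornology.IsBounded (Ω : Set (Rn n))) :
    {x : ℝ | eigenspace Ω (x : ℂ) ≠ ⊥}.Infinite := by
  intro hfin
  have := hfin.to_subtype
  have hfd := finiteDimensional_eigenspace hn hbdd
  let V : Submodule ℂ (H10 Ω) :=
    ⨆ x : {x : ℝ | eigenspace Ω (x : ℂ) ≠ ⊥}, eigenspace Ω (x.1 : ℂ)
  have hV : FiniteDimensional ℂ V := by
    have := fun x : {x : ℝ | eigenspace Ω (x : ℂ) ≠ ⊥} => hfd (x.1 : ℂ)
    exact Submodule.finiteDimensional_iSup _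
  have htop : V = ⊤ := by
    rw [← Submodule.orthogonal_eq_bot_iff, Submodule.eq_bot_iff]
    intro w hw
    refine eq_zero_of_orthogonal_dirichlet hbdd fun z u hu hz => ?_
    obtain ⟨x, -, rfl⟩ := hz.exists_real hn hbdd hu
    have hmem := (mem_eigenspace_iff hn hbdd).mpr hz
    have hx : eigenspace Ω (x : ℂ) ≠ ⊥ := fun h => hu ((Submodule.eq_bot_iff _).mp h u hmem)
    exact (Submodule.mem_orthogonal _ _).mp hw u
      (Submodule.mem_iSup_of_mem (⟨x, hx⟩ : {x : ℝ | eigenspace Ω (x : ℂ) ≠ ⊥}) hmem)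
  rw [htop] at hV
  exact not_finiteDimensional_H10 hn hne (Module.Finite.equiv (Submodule.topEquiv))

/-- Rayleigh's principle for the least eigenvalue: the norm of the self-adjoint operator
`resolventOp Ω` is its spectral radius, which is at most `(1 + a)⁻¹`. -/
lemma mul_norm_sq_le_of_le_eigenvalues (hn : 1 ≤ n)
    (hbdd : Bornology.IsBounded (Ω : Set (Rn n))) {a : ℝ} (ha : 0 < a)
    (hmin : ∀ x : ℝ, eigenspace Ω (x : ℂ) ≠ ⊥ → a ≤ x) (u : H10 Ω) :
    a * ‖fn u‖ ^ 2 ≤ ‖grad u‖ ^ 2 := by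
  have hnorm : ‖resolventOp Ω‖ ≤ (1 + a)⁻¹ := by
    have h1 := (resolventOp Ω).spectralRadius_eq_nnnorm
      (isSymmetric_resolventOp (Ω := Ω)).isSelfAdjoint
    have h2 : spectralRadius ℂ (resolventOp Ω) ≤ ENNReal.ofReal (1 + a)⁻¹ := by
      refine iSup₂_le fun μ hμ => ?_
      by_cases hμ0 : μ = 0
      · simp [hμ0]
      have h3 := ((isCompactOperator_resolventOp hbdd).hasEigenvalue_iff_mem_spectrum hμ0).mpr hμ
      obtain ⟨e, he, he0⟩ := h3.exists_hasEigenvector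
      have h4 := isDirichlet_of_mem_eigenspace he
      obtain ⟨x, hx, hxμ⟩ := h4.exists_real hn hbdd he0
      have h5 : a ≤ x := by
        refine hmin x fun h => he0 ((Submodule.eq_bot_iff _).mp h e ?_)
        rw [← hxμ]
        exact (mem_eigenspace_iff hn hbdd).mpr h4
      have h6 : μ = ((1 + x)⁻¹ : ℝ) := by
        push_cast
        rw [← hxμ, add_sub_cancel, inv_inv]
      rw [h6]
      change ‖(((1 + x)⁻¹ : ℝ) : ℂ)‖ₑ ≤ _
      rw [← ofReal_norm]
      refine ENNReal.ofReal_le_ofReal ?_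
      rw [Complex.norm_real, Real.norm_of_nonneg (by positivity)]
      gcongr
    rw [h1] at h2
    change ‖resolventOp Ω‖ₑ ≤ _ at h2
    rw [← ofReal_norm] at h2
    exact (ENNReal.ofReal_le_ofReal_iff (by positivity)).mp h2
  have h7 : ‖fn u‖ ^ 2 ≤ (1 + a)⁻¹ * ‖u‖ ^ 2 := by
    have h8 : (‖fn u‖ ^ 2 : ℂ) = ⟪u, resolventOp Ω u⟫_ℂ := by
      rw [inner_resolventOp, inner_self_eq_norm_sq_to_K]
      rfl
    have h9 : ‖fn u‖ ^ 2 = ‖⟪u, resolventOp Ω u⟫_ℂ‖ := by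
      rw [← h8]
      simp
    rw [h9]
    calc ‖⟪u, resolventOp Ω u⟫_ℂ‖ ≤ ‖u‖ * (‖resolventOp Ω‖ * ‖u‖) :=
          (norm_inner_le_norm _ _).trans (by gcongr; exact (resolventOp Ω).le_opNorm u)
      _ = ‖resolventOp Ω‖ * ‖u‖ ^ 2 := by ring
      _ ≤ _ := by gcongr
  rw [norm_sq_H10, inv_mul_eq_div, le_div_iff₀ (by positivity)] at h7
  linarith

/-! ### The energy form of the least eigenvalue -/

/-- The quadratic form `‖∇u‖² - a ‖u‖²`. -/
def energy (a : ℝ) (u : H10 Ω) : ℝ := ‖grad u‖ ^ 2 - a * ‖fn u‖ ^ 2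

/-- The sesquilinear form `(∇u, ∇v) - a (u, v)` as a semi-inner product, when it is
nonnegative. -/
@[reducible] def energyCore (a : ℝ) (h : ∀ u : H10 Ω, 0 ≤ energy a u) :
    PreInnerProductSpace.Core ℂ (H10 Ω) where
  inner v u := ⟪grad v, grad u⟫_ℂ - a * ⟪fn v, fn u⟫_ℂ
  conj_inner_symm u v := by
    simp only [map_sub, map_mul, inner_conj_symm, Complex.conj_ofReal]
  re_inner_nonneg u := by
    have := h u
    rw [energy, ← inner_self_eq_norm_sq (𝕜 := ℂ), ← inner_self_eq_norm_sq (𝕜 := ℂ)] at this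
    simpa using this
  add_left u v w := by
    simp only [grad_add, fn_add, inner_add_left]
    ring
  smul_left u v c := by
    simp only [grad_smul, fn_smul, inner_smul_left]
    ring

/-- The Cauchy–Schwarz inequality for the energy form. -/
lemma norm_sq_energy_form_le {a : ℝ} (h : ∀ u : H10 Ω, 0 ≤ energy a u) (v u : H10 Ω) :
    ‖⟪grad v, grad u⟫_ℂ - a * ⟪fn v, fn u⟫_ℂ‖ ^ 2 ≤ energy a v * energy a u := by
  have h1 : ‖⟪grad v, grad u⟫_ℂ - a * ⟪fn v, fn u⟫_ℂ‖ *
      ‖⟪grad u, grad v⟫_ℂ - a * ⟪fn u, fn v⟫_ℂ‖ ≤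
      RCLike.re (⟪grad v, grad v⟫_ℂ - a * ⟪fn v, fn v⟫_ℂ) *
        RCLike.re (⟪grad u, grad u⟫_ℂ - a * ⟪fn u, fn u⟫_ℂ) :=
    @InnerProductSpace.Core.inner_mul_inner_self_le ℂ _ _ _ _ (energyCore a h) v u
  have h2 : ∀ w : H10 Ω,
      RCLike.re (⟪grad w, grad w⟫_ℂ - a * ⟪fn w, fn w⟫_ℂ) = energy a w := by
    intro w
    rw [energy, ← inner_self_eq_norm_sq (𝕜 := ℂ) (grad w), ← inner_self_eq_norm_sq (𝕜 := ℂ) (fn w)]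
    simp
  have h3 : ‖⟪grad u, grad v⟫_ℂ - a * ⟪fn u, fn v⟫_ℂ‖ =
      ‖⟪grad v, grad u⟫_ℂ - a * ⟪fn v, fn u⟫_ℂ‖ := by
    rw [← RCLike.norm_conj, map_sub, map_mul, inner_conj_symm, inner_conj_symm]
    simp
  rwa [h2, h2, h3, ← pow_two] at h1

/-- Functions of zero energy lie in the kernel of the form, that is, they are eigenfunctions. -/
lemma isDirichlet_of_energy_eq_zero {a : ℝ} (h : ∀ u : H10 Ω, 0 ≤ energy a u) {u : H10 Ω}
    (hu : energy a u = 0) : IsDirichlet (a : ℂ) u := by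
  intro v
  have h1 := norm_sq_energy_form_le h v u
  rw [hu, mul_zero] at h1
  have h2 := pow_eq_zero_iff (two_ne_zero) |>.mp (le_antisymm h1 (sq_nonneg _))
  exact sub_eq_zero.mp (norm_eq_zero.mp h2)

lemma IsDirichlet.energy_eq_zero {a : ℝ} {u : H10 Ω} (hu : IsDirichlet (a : ℂ) u) :
    energy a u = 0 := by
  have := hu.norm_sq
  rw [energy, sub_eq_zero]
  exact_mod_cast this

lemma energy_sub_le {a : ℝ} (h : ∀ u : H10 Ω, 0 ≤ energy a u) (u v : H10 Ω) :
    energy a (u - v) ≤ 2 * (energy a u + energy a v) := by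
  have h1 := h (u + v)
  have h2 := parallelogram_law_with_norm ℂ (grad u) (grad v)
  have h3 := parallelogram_law_with_norm ℂ (fn u) (fn v)
  simp only [energy, grad_add, grad_sub, fn_add, fn_sub] at h1 ⊢
  have h4 : a * ‖fn u - fn v‖ ^ 2 =
      a * (2 * (‖fn u‖ ^ 2 + ‖fn v‖ ^ 2)) - a * ‖fn u + fn v‖ ^ 2 := by
    rw [← h3]
    ring
  nlinarith

lemma continuous_energy (a : ℝ) : Continuous (energy a : H10 Ω → ℝ) :=
  (gradL.continuous.norm.pow 2).sub (continuous_const.mul (fnL.continuous.norm.pow 2))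

/-- A minimizing sequence that converges in `L²` converges in `H¹` to a minimizer: its limit is an
eigenfunction. -/
lemma exists_isDirichlet_of_tendsto {a : ℝ} (ha : 0 < a) (h : ∀ u : H10 Ω, 0 ≤ energy a u)
    {u : ℕ → H10 Ω} (hu : Tendsto (fun k => energy a (u k)) atTop (𝓝 0)) {f : L2 Ω}
    (hf : Tendsto (fun k => fn (u k)) atTop (𝓝 f)) :
    ∃ w : H10 Ω, IsDirichlet (a : ℂ) w ∧ fn w = f := by
  have hcau : CauchySeq u := by
    rw [Metric.cauchySeq_iff']
    intro ε hε
    obtain ⟨N₁, hN₁⟩ := Metric.cauchySeq_iff.mp hf.cauchySeq (ε / (2 * (1 + a))) (by positivity)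
    obtain ⟨N₂, hN₂⟩ := eventually_atTop.mp (hu.eventually_lt_const
      (show (0 : ℝ) < ε ^ 2 / 8 by positivity))
    refine ⟨max N₁ N₂, fun k hk => ?_⟩
    have h2 := hN₁ k (le_of_max_le_left hk) (max N₁ N₂) (le_max_left _ _)
    have h3 := hN₂ k (le_of_max_le_right hk)
    have h4 := hN₂ (max N₁ N₂) (le_max_right _ _)
    set v := u (max N₁ N₂)
    have h5 := energy_sub_le h (u k) v
    have h6 : ‖u k - v‖ ^ 2 = energy a (u k - v) + (1 + a) * ‖fn (u k) - fn v‖ ^ 2 := by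
      rw [norm_sq_H10, energy, fn_sub]
      ring
    rw [dist_eq_norm, lt_div_iff₀ (by positivity)] at h2
    have h7 : (1 + a) * ‖fn (u k) - fn v‖ ^ 2 < ε ^ 2 / 4 := by
      have h8 := norm_nonneg (fn (u k) - fn v)
      have h9 : ((1 + a) * ‖fn (u k) - fn v‖) ^ 2 < (ε / 2) ^ 2 := by
        gcongr
        linarith
      have h10 : (1 + a) * ‖fn (u k) - fn v‖ ^ 2 ≤ ((1 + a) * ‖fn (u k) - fn v‖) ^ 2 := by
        rw [mul_pow]
        gcongr
        nlinarith
      linarith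
    rw [dist_eq_norm]
    refine (sq_lt_sq₀ (norm_nonneg _) hε.le).mp ?_
    nlinarith
  obtain ⟨w, hw⟩ := cauchySeq_tendsto_of_complete hcau
  refine ⟨w, isDirichlet_of_energy_eq_zero h ?_, ?_⟩
  · exact tendsto_nhds_unique (((continuous_energy a).tendsto w).comp hw) hu
  · exact tendsto_nhds_unique ((fnL.continuous.tendsto w).comp hw) hf

/-! ### Real parts and absolute values of first eigenfunctions -/

/-- The partial derivative of a real test function. -/
def pdR (φ : 𝓓(Ω, ℝ)) (i : Fin n) (x : Rn n) : ℝ := fderiv ℝ φ x (EuclideanSpace.single i 1)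

/-- A real test function, as an element of `H¹₀(Ω)`. -/
def ofTestR (φ : 𝓓(Ω, ℝ)) : H10 Ω := ofTest (ofRealTest φ)

lemma fn_ofTestR_ae (φ : 𝓓(Ω, ℝ)) :
    fn (ofTestR φ) =ᵐ[volume.restrict (Ω : Set (Rn n))] fun x => (φ x : ℂ) :=
  fn_ofTest_ae _

lemma classicalGrad_ofRealTest (φ : 𝓓(Ω, ℝ)) (x : Rn n) :
    classicalGrad (ofRealTest φ) x = WithLp.toLp 2 fun i => (pdR φ i x : ℂ) := by
  ext i
  exact pd_ofRealTest φ i x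

/-- The real part of a test function. -/
def reTest (φ : 𝓓(Ω, ℂ)) : 𝓓(Ω, ℝ) :=
  postcomp Complex.re Complex.reCLM.contDiff Complex.zero_re φ

/-- The imaginary part of a test function. -/
def imTest (φ : 𝓓(Ω, ℂ)) : 𝓓(Ω, ℝ) :=
  postcomp Complex.im Complex.imCLM.contDiff Complex.zero_im φ

lemma pdR_reTest (φ : 𝓓(Ω, ℂ)) (i : Fin n) (x : Rn n) :
    pdR (reTest φ) i x = (pd φ i x).re := by
  have h : HasFDerivAt (reTest φ) (Complex.reCLM.comp (fderiv ℝ φ x)) x :=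
    Complex.reCLM.hasFDerivAt.comp x (hasFDerivAt_test φ x)
  rw [pdR, h.fderiv]
  rfl

lemma pdR_imTest (φ : 𝓓(Ω, ℂ)) (i : Fin n) (x : Rn n) :
    pdR (imTest φ) i x = (pd φ i x).im := by
  have h : HasFDerivAt (imTest φ) (Complex.imCLM.comp (fderiv ℝ φ x)) x :=
    Complex.imCLM.hasFDerivAt.comp x (hasFDerivAt_test φ x)
  rw [pdR, h.fderiv]
  rfl

lemma norm_sq_fn_ofTest (φ : 𝓓(Ω, ℂ)) :
    ‖fn (ofTest φ)‖ ^ 2 = ∫ x in (Ω : Set (Rn n)), ‖φ x‖ ^ 2 := by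
  have h := inner_self_eq_norm_sq (𝕜 := ℂ) (fn (ofTest φ))
  rw [← h, L2.inner_def, ← integral_re (L2.integrable_inner _ _)]
  refine integral_congr_ae ?_
  filter_upwards [fn_ofTest_ae φ] with x hx
  rw [hx, inner_self_eq_norm_sq]

lemma norm_sq_grad_ofTest (φ : 𝓓(Ω, ℂ)) :
    ‖grad (ofTest φ)‖ ^ 2 = ∫ x in (Ω : Set (Rn n)), ‖classicalGrad φ x‖ ^ 2 := by
  have h := inner_self_eq_norm_sq (𝕜 := ℂ) (grad (ofTest φ))
  rw [← h, L2.inner_def, ← integral_re (L2.integrable_inner _ _)]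
  refine integral_congr_ae ?_
  filter_upwards [grad_ofTest_ae φ] with x hx
  rw [hx, inner_self_eq_norm_sq]

lemma integrable_norm_sq {α E : Type*} [MeasurableSpace α] {μ : Measure α} [NormedAddCommGroup E]
    {f : α → E} (hf : MemLp f 2 μ) : Integrable (fun x => ‖f x‖ ^ 2) μ :=
  (memLp_two_iff_integrable_sq_norm hf.1).mp hf

lemma energy_re_add_energy_im (a : ℝ) (φ : 𝓓(Ω, ℂ)) :
    energy a (ofTestR (reTest φ)) + energy a (ofTestR (imTest φ)) = energy a (ofTest φ) := by
  have h1 : ‖fn (ofTestR (reTest φ))‖ ^ 2 + ‖fn (ofTestR (imTest φ))‖ ^ 2 =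
      ‖fn (ofTest φ)‖ ^ 2 := by
    rw [ofTestR, ofTestR, norm_sq_fn_ofTest, norm_sq_fn_ofTest, norm_sq_fn_ofTest,
      ← integral_add (integrable_norm_sq (memLp_test _))
        (integrable_norm_sq (memLp_test _))]
    refine integral_congr_ae (Eventually.of_forall fun x => ?_)
    simp only [ofRealTest_apply, Complex.norm_real, Real.norm_eq_abs, sq_abs]
    rw [Complex.sq_norm, Complex.normSq_apply, ← pow_two, ← pow_two]
    rfl
  have h2 : ‖grad (ofTestR (reTest φ))‖ ^ 2 + ‖grad (ofTestR (imTest φ))‖ ^ 2 =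
      ‖grad (ofTest φ)‖ ^ 2 := by
    rw [ofTestR, ofTestR, norm_sq_grad_ofTest, norm_sq_grad_ofTest, norm_sq_grad_ofTest,
      ← integral_add (integrable_norm_sq (memLp_classicalGrad _))
        (integrable_norm_sq (memLp_classicalGrad _))]
    refine integral_congr_ae (Eventually.of_forall fun x => ?_)
    simp only [classicalGrad_ofRealTest, EuclideanSpace.norm_sq_eq, ← Finset.sum_add_distrib]
    refine Finset.sum_congr rfl fun i _ => ?_
    simp only [pdR_reTest, pdR_imTest, Complex.norm_real, Real.norm_eq_abs, sq_abs, classicalGrad]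
    rw [Complex.sq_norm, Complex.normSq_apply, ← pow_two, ← pow_two]
  rw [energy, energy, energy, ← h1, ← h2]
  ring

/-- The smooth approximation `√(t² + ε²) - ε` of `|t|`. -/
def smoothAbs (ε t : ℝ) : ℝ := √(t ^ 2 + ε ^ 2) - ε

lemma contDiff_smoothAbs {ε : ℝ} (hε : 0 < ε) : ContDiff ℝ ∞ (smoothAbs ε) :=
  (((contDiff_id.pow 2).add contDiff_const).sqrt fun t => by
    simp only [id]; positivity).sub contDiff_const

lemma smoothAbs_zero {ε : ℝ} (hε : 0 < ε) : smoothAbs ε 0 = 0 := by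
  simp [smoothAbs, Real.sqrt_sq hε.le]

lemma smoothAbs_nonneg (ε t : ℝ) : 0 ≤ smoothAbs ε t := by
  rw [smoothAbs, sub_nonneg]
  exact Real.le_sqrt_of_sq_le (by nlinarith [sq_nonneg t])

lemma abs_smoothAbs_sub_le {ε : ℝ} (hε : 0 < ε) (t : ℝ) : |smoothAbs ε t - abs t| ≤ ε := by
  have h1 : |t| ≤ √(t ^ 2 + ε ^ 2) := Real.abs_le_sqrt (by nlinarith [sq_nonneg ε])
  have h2 : √(t ^ 2 + ε ^ 2) ≤ |t| + ε := by
    rw [Real.sqrt_le_left (by positivity)]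
    nlinarith [abs_nonneg t, sq_abs t]
  rw [smoothAbs, abs_le]
  constructor <;> linarith

lemma abs_deriv_smoothAbs_le {ε : ℝ} (hε : 0 < ε) (t : ℝ) : |deriv (smoothAbs ε) t| ≤ 1 := by
  have h0 : 0 < t ^ 2 + ε ^ 2 := by positivity
  have h1 : HasDerivAt (smoothAbs ε) (2 * t / (2 * √(t ^ 2 + ε ^ 2))) t := by
    have : HasDerivAt (fun t => √(t ^ 2 + ε ^ 2)) (2 * t / (2 * √(t ^ 2 + ε ^ 2))) t := by
      simpa using ((hasDerivAt_pow 2 t).add_const (ε ^ 2)).sqrt h0.ne'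
    exact this.sub_const ε
  rw [h1.deriv, mul_div_mul_left _ _ two_ne_zero, abs_div, abs_of_nonneg (Real.sqrt_nonneg _)]
  refine div_le_one_of_le₀ (Real.abs_le_sqrt (by nlinarith [sq_nonneg ε])) (Real.sqrt_nonneg _)

lemma pdR_postcomp {G : ℝ → ℝ} (hG : ContDiff ℝ ∞ G) (h0 : G 0 = 0) (φ : 𝓓(Ω, ℝ)) (i : Fin n)
    (x : Rn n) : pdR (postcomp G hG h0 φ) i x = deriv G (φ x) * pdR φ i x := by
  have h1 : HasDerivAt G (deriv G (φ x)) (φ x) :=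
    (hG.differentiable (by simp)).differentiableAt.hasDerivAt
  have h : HasFDerivAt (postcomp G hG h0 φ) (deriv G (φ x) • fderiv ℝ φ x) x :=
    h1.comp_hasFDerivAt x (hasFDerivAt_test φ x)
  rw [pdR, h.fderiv]
  rfl

lemma norm_grad_postcomp_le {G : ℝ → ℝ} (hG : ContDiff ℝ ∞ G) (h0 : G 0 = 0)
    (h1 : ∀ t, |deriv G t| ≤ 1) (φ : 𝓓(Ω, ℝ)) :
    ‖grad (ofTestR (postcomp G hG h0 φ))‖ ≤ ‖grad (ofTestR φ)‖ := by
  refine Lp.norm_le_norm_of_ae_le ?_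
  filter_upwards [grad_ofTest_ae (ofRealTest (postcomp G hG h0 φ)),
    grad_ofTest_ae (ofRealTest φ)] with x hx1 hx2
  rw [ofTestR, ofTestR, hx1, hx2, classicalGrad_ofRealTest, classicalGrad_ofRealTest,
    EuclideanSpace.norm_eq, EuclideanSpace.norm_eq]
  refine Real.sqrt_le_sqrt (Finset.sum_le_sum fun i _ => ?_)
  simp only [pdR_postcomp, Complex.norm_real, norm_mul, Real.norm_eq_abs]
  gcongr
  exact mul_le_of_le_one_left (abs_nonneg _) (h1 _)

lemma lipschitzWith_re : LipschitzWith 1 fun z : ℂ => (z.re : ℂ) :=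
  LipschitzWith.of_dist_le_mul fun z w => by
    rw [dist_eq_norm, dist_eq_norm, ← Complex.ofReal_sub, Complex.norm_real, ← Complex.sub_re]
    simpa using Complex.abs_re_le_norm (z - w)

lemma lipschitzWith_abs_re : LipschitzWith 1 fun z : ℂ => ((|z.re| : ℝ) : ℂ) :=
  LipschitzWith.of_dist_le_mul fun z w => by
    rw [dist_eq_norm, dist_eq_norm, ← Complex.ofReal_sub, Complex.norm_real]
    refine (abs_abs_sub_abs_le _ _).trans ?_
    rw [← Complex.sub_re]
    simpa using Complex.abs_re_le_norm (z - w)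

/-- The real part on `L²(Ω)`. -/
def reL2 (f : L2 Ω) : L2 Ω := lipschitzWith_re.compLp (by simp) f

/-- The absolute value of the real part on `L²(Ω)`. -/
def absReL2 (f : L2 Ω) : L2 Ω := lipschitzWith_abs_re.compLp (by simp) f

lemma reL2_ae (f : L2 Ω) :
    reL2 f =ᵐ[volume.restrict (Ω : Set (Rn n))] fun x => ((f x).re : ℂ) :=
  lipschitzWith_re.coeFn_compLp _ f

lemma absReL2_ae (f : L2 Ω) :
    absReL2 f =ᵐ[volume.restrict (Ω : Set (Rn n))] fun x => ((|(f x).re| : ℝ) : ℂ) :=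
  lipschitzWith_abs_re.coeFn_compLp _ f

lemma continuous_reL2 : Continuous (reL2 : L2 Ω → L2 Ω) :=
  lipschitzWith_re.continuous_compLp (by simp)

lemma continuous_absReL2 : Continuous (absReL2 : L2 Ω → L2 Ω) :=
  lipschitzWith_abs_re.continuous_compLp (by simp)

lemma fn_ofTestR_reTest (φ : 𝓓(Ω, ℂ)) : fn (ofTestR (reTest φ)) = reL2 (fn (ofTest φ)) := by
  refine Lp.ext ?_
  filter_upwards [fn_ofTestR_ae (reTest φ), reL2_ae (fn (ofTest φ)), fn_ofTest_ae φ]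
    with x h1 h2 h3
  rw [h1, h2, h3]
  rfl

/-- For a first eigenfunction `u`, the functions `Re u` and `|Re u|` are limits in `L²` of
minimizing sequences of real test functions, nonnegative ones in the second case. -/
lemma IsDirichlet.exists_minimizing {a : ℝ} (h : ∀ u : H10 Ω, 0 ≤ energy a u)
    [IsFiniteMeasure (volume.restrict (Ω : Set (Rn n)))]
    {u : H10 Ω} (hu : IsDirichlet (a : ℂ) u) :
    (∃ φ : ℕ → 𝓓(Ω, ℝ), Tendsto (fun k => energy a (ofTestR (φ k))) atTop (𝓝 0) ∧
      Tendsto (fun k => fn (ofTestR (φ k))) atTop (𝓝 (reL2 (fn u)))) ∧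
    (∃ φ : ℕ → 𝓓(Ω, ℝ), (∀ k x, 0 ≤ φ k x) ∧
      Tendsto (fun k => energy a (ofTestR (φ k))) atTop (𝓝 0) ∧
      Tendsto (fun k => fn (ofTestR (φ k))) atTop (𝓝 (absReL2 (fn u)))) := by
  obtain ⟨φ, hφ⟩ := exists_seq_ofTest u
  have hE : Tendsto (fun k => energy a (ofTest (φ k))) atTop (𝓝 0) := by
    rw [← hu.energy_eq_zero]
    exact ((continuous_energy a).tendsto u).comp hφ
  have hfn : Tendsto (fun k => fn (ofTest (φ k))) atTop (𝓝 (fn u)) :=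
    (fnL.continuous.tendsto u).comp hφ
  have hle : ∀ k, energy a (ofTestR (reTest (φ k))) ≤ energy a (ofTest (φ k)) := fun k => by
    have := energy_re_add_energy_im a (φ k)
    have := h (ofTestR (imTest (φ k)))
    linarith
  have hre : Tendsto (fun k => fn (ofTestR (reTest (φ k)))) atTop (𝓝 (reL2 (fn u))) := by
    simp_rw [fn_ofTestR_reTest]
    exact (continuous_reL2.tendsto _).comp hfn
  refine ⟨⟨fun k => reTest (φ k), squeeze_zero (fun k => h _) hle hE, hre⟩, ?_⟩
  have hpos : ∀ k : ℕ, (0 : ℝ) < 1 / (k + 1) := fun k => by positivity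
  let ψ : ℕ → 𝓓(Ω, ℝ) := fun k => postcomp (smoothAbs (1 / (k + 1))) (contDiff_smoothAbs (hpos k))
    (smoothAbs_zero (hpos k)) (reTest (φ k))
  have hψ : Tendsto (fun k => fn (ofTestR (ψ k))) atTop (𝓝 (absReL2 (fn u))) := by
    have h1 : Tendsto (fun k => absReL2 (fn (ofTest (φ k)))) atTop (𝓝 (absReL2 (fn u))) :=
      (continuous_absReL2.tendsto _).comp hfn
    have h2 : Tendsto (fun k => fn (ofTestR (ψ k)) - absReL2 (fn (ofTest (φ k)))) atTop (𝓝 0) := by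
      refine squeeze_zero_norm (a := fun k : ℕ =>
        (measureUnivNNReal (volume.restrict (Ω : Set (Rn n))) : ℝ) ^ (2 : ℝ≥0∞).toReal⁻¹ *
          (1 / ((k : ℝ) + 1))) (fun k => ?_) ?_
      · refine Lp.norm_le_of_ae_bound (hpos k).le ?_
        filter_upwards [Lp.coeFn_sub (fn (ofTestR (ψ k))) (absReL2 (fn (ofTest (φ k)))),
          fn_ofTestR_ae (ψ k), absReL2_ae (fn (ofTest (φ k))), fn_ofTest_ae (φ k)]
          with x h3 h4 h5 h6
        rw [h3, Pi.sub_apply, h4, h5, h6, ← Complex.ofReal_sub, Complex.norm_real]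
        exact abs_smoothAbs_sub_le (hpos k) _
      · simpa using (tendsto_one_div_add_atTop_nhds_zero_nat (𝕜 := ℝ)).const_mul
          ((measureUnivNNReal (volume.restrict (Ω : Set (Rn n))) : ℝ) ^ (2 : ℝ≥0∞).toReal⁻¹)
    simpa using h2.add h1
  refine ⟨ψ, fun k x => smoothAbs_nonneg _ _, ?_, hψ⟩
  -- `|∇ψ k| ≤ |∇ Re (φ k)|`, and the `L²` norms have the same limit
  have hnorm : ‖reL2 (fn u)‖ = ‖absReL2 (fn u)‖ := by
    refine le_antisymm (Lp.norm_le_norm_of_ae_le ?_) (Lp.norm_le_norm_of_ae_le ?_) <;>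
    · filter_upwards [reL2_ae (fn u), absReL2_ae (fn u)] with x h1 h2
      rw [h1, h2]
      simp
  refine squeeze_zero (g := fun k => energy a (ofTest (φ k)) +
    a * (‖fn (ofTestR (reTest (φ k)))‖ ^ 2 - ‖fn (ofTestR (ψ k))‖ ^ 2)) (fun k => h _)
    (fun k => ?_) ?_
  · have h1 : ‖grad (ofTestR (ψ k))‖ ^ 2 ≤ ‖grad (ofTestR (reTest (φ k)))‖ ^ 2 := by
      gcongr
      exact norm_grad_postcomp_le _ _ (abs_deriv_smoothAbs_le (hpos k)) _
    have h2 := hle k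
    rw [energy] at h2 ⊢
    linarith
  · have h1 := hE.add (((hre.norm.pow 2).sub (hψ.norm.pow 2)).const_mul a)
    rw [hnorm] at h1
    simpa using h1

/-! ### The logarithmic estimate -/

/-- The test function `ψ² / (φ + ε)`. -/
def quotTest (ψ φ : 𝓓(Ω, ℝ)) (hφ : ∀ x, 0 ≤ φ x) {ε : ℝ} (hε : 0 < ε) : 𝓓(Ω, ℝ) where
  toFun x := ψ x ^ 2 / (φ x + ε)
  contDiff' := (ψ.contDiff.pow 2).div (φ.contDiff.add contDiff_const) fun x => by
    have := hφ x
    positivity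
  hasCompactSupport' := HasCompactSupport.intro ψ.hasCompactSupport fun x hx => by
    simp [image_eq_zero_of_notMem_tsupport hx]
  tsupport_subset' := by
    refine (closure_minimal (fun x hx => ?_) (isClosed_tsupport ψ)).trans ψ.tsupport_subset
    by_contra h
    exact hx (by simp [image_eq_zero_of_notMem_tsupport h])

/-- The test function `log (1 + φ / ε)`. -/
def logTest (φ : 𝓓(Ω, ℝ)) (hφ : ∀ x, 0 ≤ φ x) {ε : ℝ} (hε : 0 < ε) : 𝓓(Ω, ℝ) where
  toFun x := Real.log (1 + φ x / ε)
  contDiff' := (contDiff_const.add (φ.contDiff.div_const ε)).log fun x => by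
    have := hφ x
    positivity
  hasCompactSupport' := HasCompactSupport.intro φ.hasCompactSupport fun x hx => by
    simp [image_eq_zero_of_notMem_tsupport hx]
  tsupport_subset' := by
    refine (closure_minimal (fun x hx => ?_) (isClosed_tsupport φ)).trans φ.tsupport_subset
    by_contra h
    exact hx (by simp [image_eq_zero_of_notMem_tsupport h])

lemma pdR_quotTest (ψ φ : 𝓓(Ω, ℝ)) (hφ : ∀ x, 0 ≤ φ x) {ε : ℝ} (hε : 0 < ε) (i : Fin n)
    (x : Rn n) : pdR (quotTest ψ φ hφ hε) i x =
      2 * ψ x * pdR ψ i x / (φ x + ε) - ψ x ^ 2 * pdR φ i x / (φ x + ε) ^ 2 := by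
  have h0 : φ x + ε ≠ 0 := by
    have := hφ x
    positivity
  have h1 := ((hasFDerivAt_test ψ x).pow 2).mul
    ((hasDerivAt_inv h0).comp_hasFDerivAt x ((hasFDerivAt_test φ x).add_const ε))
  have h2 : HasFDerivAt (quotTest ψ φ hφ hε) _ x := h1
  rw [pdR, h2.fderiv]
  simp only [pdR, add_apply, smul_apply, smul_eq_mul, Function.comp_apply]
  field_simp
  simp
  ring

lemma pdR_logTest (φ : 𝓓(Ω, ℝ)) (hφ : ∀ x, 0 ≤ φ x) {ε : ℝ} (hε : 0 < ε) (i : Fin n)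
    (x : Rn n) : pdR (logTest φ hφ hε) i x = pdR φ i x / (φ x + ε) := by
  have h0 : φ x + ε ≠ 0 := by
    have := hφ x
    positivity
  have h3 : 1 + φ x / ε ≠ 0 := by
    have := hφ x
    positivity
  have h1 := (((hasFDerivAt_test φ x).mul_const ε⁻¹).const_add 1).log
    (by simpa [div_eq_mul_inv] using h3)
  have h2 : HasFDerivAt (logTest φ hφ hε) _ x := h1
  rw [pdR, h2.fderiv]
  simp only [pdR, smul_apply, smul_eq_mul]
  have h4 : ε + φ x ≠ 0 := by rwa [add_comm]
  field_simp
  ring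

lemma continuous_pdR (φ : 𝓓(Ω, ℝ)) (i : Fin n) : Continuous (pdR φ i) :=
  (φ.contDiff.continuous_fderiv (by simp)).clm_apply continuous_const

lemma hasCompactSupport_pdR (φ : 𝓓(Ω, ℝ)) (i : Fin n) : HasCompactSupport (pdR φ i) :=
  φ.hasCompactSupport.fderiv_apply ℝ _

lemma integrable_pdR_mul (φ : 𝓓(Ω, ℝ)) (i : Fin n) {f : Rn n → ℝ} (hf : Continuous f) :
    Integrable (fun x => pdR φ i x * f x) (volume.restrict (Ω : Set (Rn n))) :=
  (((continuous_pdR φ i).mul hf).integrable_of_hasCompactSupport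
    (hasCompactSupport_pdR φ i).mul_right).restrict

lemma integrable_test_mul (φ : 𝓓(Ω, ℝ)) {f : Rn n → ℝ} (hf : Continuous f) :
    Integrable (fun x => φ x * f x) (volume.restrict (Ω : Set (Rn n))) :=
  ((φ.continuous.mul hf).integrable_of_hasCompactSupport
    φ.hasCompactSupport.mul_right).restrict

lemma exists_bound_test (φ : 𝓓(Ω, ℝ)) : ∃ M : ℝ, ∀ x, |φ x| ≤ M := by
  obtain ⟨M, hM⟩ := φ.continuous.bounded_above_of_compact_support φ.hasCompactSupport
  exact ⟨M, hM⟩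

lemma exists_bound_pdR (φ : 𝓓(Ω, ℝ)) (i : Fin n) : ∃ M : ℝ, ∀ x, |pdR φ i x| ≤ M := by
  obtain ⟨M, hM⟩ := (continuous_pdR φ i).bounded_above_of_compact_support
    (hasCompactSupport_pdR φ i)
  exact ⟨M, hM⟩

lemma inner_grad_ofTestR (φ θ : 𝓓(Ω, ℝ)) : ⟪grad (ofTestR φ), grad (ofTestR θ)⟫_ℂ =
    ((∫ x in (Ω : Set (Rn n)), ∑ i, pdR φ i x * pdR θ i x : ℝ) : ℂ) := by
  rw [L2.inner_def, ← integral_complex_ofReal]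
  refine integral_congr_ae ?_
  filter_upwards [grad_ofTest_ae (ofRealTest φ), grad_ofTest_ae (ofRealTest θ)] with x h1 h2
  rw [ofTestR, ofTestR, h1, h2, classicalGrad_ofRealTest, classicalGrad_ofRealTest,
    PiLp.inner_apply]
  simp [mul_comm]

lemma inner_fn_ofTestR (φ θ : 𝓓(Ω, ℝ)) : ⟪fn (ofTestR φ), fn (ofTestR θ)⟫_ℂ =
    ((∫ x in (Ω : Set (Rn n)), φ x * θ x : ℝ) : ℂ) := by
  rw [L2.inner_def, ← integral_complex_ofReal]
  refine integral_congr_ae ?_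
  filter_upwards [fn_ofTestR_ae φ, fn_ofTestR_ae θ] with x h1 h2
  rw [h1, h2]
  simp [mul_comm]

lemma norm_sq_grad_ofTestR (φ : 𝓓(Ω, ℝ)) :
    ‖grad (ofTestR φ)‖ ^ 2 = ∫ x in (Ω : Set (Rn n)), ∑ i, pdR φ i x * pdR φ i x := by
  have h := inner_grad_ofTestR φ φ
  rw [inner_self_eq_norm_sq_to_K] at h
  apply Complex.ofReal_injective
  rw [Complex.ofReal_pow]
  exact h

lemma integrable_sum_pdR_mul (φ θ : 𝓓(Ω, ℝ)) :
    Integrable (fun x => ∑ i, pdR φ i x * pdR θ i x) (volume.restrict (Ω : Set (Rn n))) :=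
  integrable_finsetSum _ fun i _ => integrable_pdR_mul φ i (continuous_pdR θ i)

/-- Testing the form with `ψ² / (φ + ε)` controls `ψ ∇ log (φ + ε)`, with a constant that does not
depend on `ε`; the last term is small when `φ` is nearly minimizing. Pointwise, the estimate is
`|ψ ∇ log (φ + ε) - 2 ∇ψ|² ≥ 0`. -/
lemma integral_sq_mul_grad_log_le {a : ℝ} (ha : 0 ≤ a) (ψ φ : 𝓓(Ω, ℝ)) (hφ : ∀ x, 0 ≤ φ x) {ε : ℝ}
    (hε : 0 < ε) :
    ∫ x in (Ω : Set (Rn n)), ∑ i, (ψ x * pdR (logTest φ hφ hε) i x) ^ 2 ≤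
      4 * ‖grad (ofTestR ψ)‖ ^ 2 +
      2 * ‖⟪grad (ofTestR φ), grad (ofTestR (quotTest ψ φ hφ hε))⟫_ℂ -
        a * ⟪fn (ofTestR φ), fn (ofTestR (quotTest ψ φ hφ hε))⟫_ℂ‖ := by
  set θ := quotTest ψ φ hφ hε with hθ
  have hpt : ∀ x, ∑ i, (ψ x * pdR (logTest φ hφ hε) i x) ^ 2 ≤
      4 * (∑ i, pdR ψ i x * pdR ψ i x) - 2 * (∑ i, pdR φ i x * pdR θ i x) +
        2 * a * (φ x * θ x) := by
    intro x
    have hx := hφ x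
    have h1 : 0 ≤ 2 * a * (φ x * θ x) := by
      have : θ x = ψ x ^ 2 / (φ x + ε) := rfl
      rw [this]
      positivity
    have h2 : ∑ i, (ψ x * pdR (logTest φ hφ hε) i x) ^ 2 ≤
        ∑ i, (4 * (pdR ψ i x * pdR ψ i x) - 2 * (pdR φ i x * pdR θ i x)) := by
      refine Finset.sum_le_sum fun i _ => ?_
      rw [hθ, pdR_quotTest, pdR_logTest]
      have h0 : φ x + ε ≠ 0 := by positivity
      rw [← sub_nonneg]
      refine (sq_nonneg (2 * pdR ψ i x - ψ x * (pdR φ i x / (φ x + ε)))).trans_eq ?_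
      field_simp
      ring
    rw [Finset.sum_sub_distrib, ← Finset.mul_sum, ← Finset.mul_sum] at h2
    linarith
  have hi1 := (integrable_sum_pdR_mul ψ ψ).const_mul 4
  have hi2 := (integrable_sum_pdR_mul φ θ).const_mul 2
  have hi12 : Integrable (fun x => 4 * (∑ i, pdR ψ i x * pdR ψ i x) -
      2 * ∑ i, pdR φ i x * pdR θ i x) (volume.restrict (Ω : Set (Rn n))) := hi1.sub hi2
  have hi3 := (integrable_test_mul φ θ.continuous).const_mul (2 * a)
  have h3 : ∫ x in (Ω : Set (Rn n)), ∑ i, (ψ x * pdR (logTest φ hφ hε) i x) ^ 2 ≤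
      4 * (∫ x in (Ω : Set (Rn n)), ∑ i, pdR ψ i x * pdR ψ i x) -
        2 * (∫ x in (Ω : Set (Rn n)), ∑ i, pdR φ i x * pdR θ i x) +
        2 * a * ∫ x in (Ω : Set (Rn n)), φ x * θ x := by
    rw [← integral_const_mul, ← integral_const_mul, ← integral_const_mul,
      ← integral_sub hi1 hi2, ← integral_add hi12 hi3]
    refine integral_mono_of_nonneg (Eventually.of_forall fun x => ?_) (hi12.add hi3)
      (Eventually.of_forall hpt)
    exact Finset.sum_nonneg fun i _ => sq_nonneg _
  rw [inner_grad_ofTestR, inner_fn_ofTestR, ← Complex.ofReal_mul, ← Complex.ofReal_sub,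
    Complex.norm_real, norm_sq_grad_ofTestR]
  have h4 := neg_abs_le ((∫ x in (Ω : Set (Rn n)), ∑ i, pdR φ i x * pdR θ i x) -
    a * ∫ x in (Ω : Set (Rn n)), φ x * θ x)
  rw [Real.norm_eq_abs]
  linarith

/-- For fixed `ε` the test functions `ψ² / (φ + ε)` stay bounded in `H¹` as long as `φ` does. -/
lemma norm_sq_grad_quotTest_le (ψ φ : 𝓓(Ω, ℝ)) (hφ : ∀ x, 0 ≤ φ x) {ε : ℝ} (hε : 0 < ε) {M : ℝ}
    (hM : ∀ x, |ψ x| ≤ M) :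
    ‖grad (ofTestR (quotTest ψ φ hφ hε))‖ ^ 2 ≤ 2 * (2 * M / ε) ^ 2 * ‖grad (ofTestR ψ)‖ ^ 2 +
      2 * (M ^ 2 / ε ^ 2) ^ 2 * ‖grad (ofTestR φ)‖ ^ 2 := by
  rw [norm_sq_grad_ofTestR, norm_sq_grad_ofTestR, norm_sq_grad_ofTestR, ← integral_const_mul,
    ← integral_const_mul, ← integral_add ((integrable_sum_pdR_mul ψ ψ).const_mul _)
      ((integrable_sum_pdR_mul φ φ).const_mul _)]
  refine integral_mono (integrable_sum_pdR_mul _ _)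
    (((integrable_sum_pdR_mul ψ ψ).const_mul _).add ((integrable_sum_pdR_mul φ φ).const_mul _))
    fun x => ?_
  simp only [Finset.mul_sum, ← Finset.sum_add_distrib]
  refine Finset.sum_le_sum fun i _ => ?_
  have hx := hφ x
  have h1 : (2 * ψ x / (φ x + ε)) ^ 2 ≤ (2 * M / ε) ^ 2 := by
    rw [← sq_abs, abs_div, abs_mul, abs_two, abs_of_nonneg (show 0 ≤ φ x + ε by positivity)]
    have := (abs_nonneg (ψ x)).trans (hM x)
    gcongr
    · exact hM x
    · linarith
  have h2 : (ψ x ^ 2 / (φ x + ε) ^ 2) ^ 2 ≤ (M ^ 2 / ε ^ 2) ^ 2 := by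
    rw [← sq_abs (ψ x)]
    gcongr
    · exact hM x
    · linarith
  have h3 : pdR (quotTest ψ φ hφ hε) i x =
      2 * ψ x / (φ x + ε) * pdR ψ i x - ψ x ^ 2 / (φ x + ε) ^ 2 * pdR φ i x := by
    rw [pdR_quotTest]
    ring
  rw [h3]
  have h4 := mul_le_mul_of_nonneg_right h1 (sq_nonneg (pdR ψ i x))
  have h5 := mul_le_mul_of_nonneg_right h2 (sq_nonneg (pdR φ i x))
  nlinarith [sq_nonneg (2 * ψ x / (φ x + ε) * pdR ψ i x + ψ x ^ 2 / (φ x + ε) ^ 2 * pdR φ i x)]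

lemma integral_mul_pdR (φ ψ : 𝓓(Ω, ℝ)) (i : Fin n) :
    ∫ x in (Ω : Set (Rn n)), φ x * pdR ψ i x = -∫ x in (Ω : Set (Rn n)), pdR φ i x * ψ x := by
  have h := integral_mul_pd (ofRealTest φ) (ofRealTest ψ) i
  simp only [pd_ofRealTest, ofRealTest_apply, ← Complex.ofReal_mul, integral_complex_ofReal] at h
  exact_mod_cast h

lemma abs_integral_logTest_mul_pdR_le [IsFiniteMeasure (volume.restrict (Ω : Set (Rn n)))]
    {a : ℝ} (ha : 0 ≤ a) (ψ φ : 𝓓(Ω, ℝ)) (hφ : ∀ x, 0 ≤ φ x) {ε : ℝ} (hε : 0 < ε) (i : Fin n) :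
    |∫ x in (Ω : Set (Rn n)), Real.log (1 + φ x / ε) * pdR ψ i x| ≤
      volume.real (Ω : Set (Rn n)) + 4 * ‖grad (ofTestR ψ)‖ ^ 2 +
      2 * ‖⟪grad (ofTestR φ), grad (ofTestR (quotTest ψ φ hφ hε))⟫_ℂ -
        a * ⟪fn (ofTestR φ), fn (ofTestR (quotTest ψ φ hφ hε))⟫_ℂ‖ := by
  set η := logTest φ hφ hε with hη
  have h1 : ∫ x in (Ω : Set (Rn n)), Real.log (1 + φ x / ε) * pdR ψ i x =
      -∫ x in (Ω : Set (Rn n)), pdR η i x * ψ x := integral_mul_pdR η ψ i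
  have hi : Integrable (fun x => ∑ i, (ψ x * pdR η i x) ^ 2)
      (volume.restrict (Ω : Set (Rn n))) := by
    refine integrable_finsetSum _ fun i _ => ?_
    refine (integrable_test_mul ψ (f := fun x => pdR η i x * (ψ x * pdR η i x)) ?_).congr
      (Eventually.of_forall fun x => by ring)
    exact (continuous_pdR η i).mul (ψ.continuous.mul (continuous_pdR η i))
  have h2 : |∫ x in (Ω : Set (Rn n)), pdR η i x * ψ x| ≤
      ∫ x in (Ω : Set (Rn n)), (1 + ∑ i, (ψ x * pdR η i x) ^ 2) := by
    rw [← Real.norm_eq_abs]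
    refine norm_integral_le_of_norm_le ((integrable_const _).add hi)
      (Eventually.of_forall fun x => ?_)
    have h3 : (ψ x * pdR η i x) ^ 2 ≤ ∑ i, (ψ x * pdR η i x) ^ 2 :=
      Finset.single_le_sum (f := fun i => (ψ x * pdR η i x) ^ 2) (fun i _ => sq_nonneg _)
        (Finset.mem_univ i)
    rw [Real.norm_eq_abs, mul_comm]
    nlinarith [sq_nonneg (|ψ x * pdR η i x| - 1), sq_abs (ψ x * pdR η i x)]
  rw [integral_add (integrable_const _) hi, integral_const, smul_eq_mul, mul_one,
    measureReal_restrict_apply_univ] at h2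
  rw [h1, abs_neg]
  have h3 := integral_sq_mul_grad_log_le ha ψ φ hφ hε
  linarith

lemma abs_log_one_add_sub_le {s t : ℝ} (hs : 0 ≤ s) (ht : 0 ≤ t) :
    |Real.log (1 + s) - Real.log (1 + t)| ≤ |s - t| := by
  have key : ∀ {s t : ℝ}, 0 ≤ s → 0 ≤ t → Real.log (1 + s) - Real.log (1 + t) ≤ |s - t| := by
    intro s t hs ht
    rw [← Real.log_div (by positivity) (by positivity)]
    refine (Real.log_le_sub_one_of_pos (by positivity)).trans ?_
    have h1 : (1 + s) / (1 + t) - 1 = (s - t) / (1 + t) := by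
      field_simp
      ring
    rw [h1]
    calc (s - t) / (1 + t) ≤ |s - t| / (1 + t) := by
          gcongr
          exact le_abs_self _
      _ ≤ |s - t| := div_le_self (abs_nonneg _) (by linarith)
  rw [abs_le]
  have h1 := key hs ht
  have h2 := key ht hs
  rw [abs_sub_comm] at h2
  constructor <;> linarith

lemma integral_norm_le_mul_norm {E : Type*} [NormedAddCommGroup E]
    [IsFiniteMeasure (volume.restrict (Ω : Set (Rn n)))]
    (d : Lp E 2 (volume.restrict (Ω : Set (Rn n)))) :
    ∫ x in (Ω : Set (Rn n)), ‖d x‖ ≤ √(volume.real (Ω : Set (Rn n))) * ‖d‖ := by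
  have h1 := sq_lintegral_le (volume.restrict (Ω : Set (Rn n))) (Lp.aestronglyMeasurable d).enorm
  rw [← enorm_sq_eq_lintegral] at h1
  rw [integral_norm_eq_lintegral_enorm (Lp.aestronglyMeasurable d)]
  have h2 := ENNReal.toReal_mono (by finiteness) h1
  rw [ENNReal.toReal_pow, ENNReal.toReal_mul, ENNReal.toReal_pow, toReal_enorm,
    Measure.restrict_apply_univ] at h2
  refine (sq_le_sq₀ ENNReal.toReal_nonneg (by positivity)).mp (h2.trans_eq ?_)
  rw [mul_pow, Real.sq_sqrt measureReal_nonneg, Measure.real]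

/-- The measurable function `log (1 + |f| / ε)` has a distributional derivative bounded uniformly
in `ε`, when `f` is the `L²` limit of a nonnegative minimizing sequence. -/
lemma abs_integral_log_mul_pdR_le [IsFiniteMeasure (volume.restrict (Ω : Set (Rn n)))]
    {a : ℝ} (ha : 0 ≤ a) (h : ∀ u : H10 Ω, 0 ≤ energy a u) {φ : ℕ → 𝓓(Ω, ℝ)}
    (hφ : ∀ k x, 0 ≤ φ k x) (hE : Tendsto (fun k => energy a (ofTestR (φ k))) atTop (𝓝 0))
    {f : L2 Ω} (hf : Tendsto (fun k => fn (ofTestR (φ k))) atTop (𝓝 f)) (ψ : 𝓓(Ω, ℝ)) (i : Fin n)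
    {ε : ℝ} (hε : 0 < ε) :
    |∫ x in (Ω : Set (Rn n)), Real.log (1 + ‖f x‖ / ε) * pdR ψ i x| ≤
      volume.real (Ω : Set (Rn n)) + 4 * ‖grad (ofTestR ψ)‖ ^ 2 := by
  obtain ⟨K, hK⟩ := exists_bound_pdR ψ i
  obtain ⟨M, hM⟩ := exists_bound_test ψ
  have hK0 : 0 ≤ K := (abs_nonneg _).trans (hK 0)
  -- the form applied to the test functions `ψ² / (φ k + ε)` tends to zero
  have hB : Tendsto (fun k =>
      ‖⟪grad (ofTestR (φ k)), grad (ofTestR (quotTest ψ (φ k) (hφ k) hε))⟫_ℂ - a *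
      ⟪fn (ofTestR (φ k)), fn (ofTestR (quotTest ψ (φ k) (hφ k) hε))⟫_ℂ‖) atTop (𝓝 0) := by
    have h1 : Tendsto (fun k => energy a (ofTestR (φ k)) * (2 * (2 * M / ε) ^ 2 *
        ‖grad (ofTestR ψ)‖ ^ 2 + 2 * (M ^ 2 / ε ^ 2) ^ 2 * (energy a (ofTestR (φ k)) +
          a * ‖fn (ofTestR (φ k))‖ ^ 2))) atTop (𝓝 0) := by
      have := hE.mul (((hE.add ((hf.norm.pow 2).const_mul a)).const_mul
        (2 * (M ^ 2 / ε ^ 2) ^ 2)).const_add (2 * (2 * M / ε) ^ 2 * ‖grad (ofTestR ψ)‖ ^ 2))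
      rwa [zero_mul] at this
    have h2 := squeeze_zero (fun k => sq_nonneg _) (fun k =>
      (norm_sq_energy_form_le h (ofTestR (φ k)) (ofTestR (quotTest ψ (φ k) (hφ k) hε))).trans
        (mul_le_mul_of_nonneg_left (?_ : _ ≤ _) (h _))) h1
    · have h3 := h2.sqrt
      simpa [Real.sqrt_sq (norm_nonneg _)] using h3
    · have h3 := norm_sq_grad_quotTest_le ψ (φ k) (hφ k) hε hM
      have h4 : energy a (ofTestR (φ k)) + a * ‖fn (ofTestR (φ k))‖ ^ 2 =
          ‖grad (ofTestR (φ k))‖ ^ 2 := by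
        rw [energy]
        ring
      rw [h4]
      refine le_trans ?_ h3
      rw [energy]
      have : 0 ≤ a * ‖fn (ofTestR (quotTest ψ (φ k) (hφ k) hε))‖ ^ 2 := by positivity
      linarith
  have hfi : Integrable (fun x => Real.log (1 + ‖f x‖ / ε) * pdR ψ i x)
      (volume.restrict (Ω : Set (Rn n))) := by
    have h1 : Integrable (fun x => ‖f x‖ / ε * K) (volume.restrict (Ω : Set (Rn n))) :=
      ((((Lp.memLp f).integrable (by norm_num)).norm).div_const ε).mul_const K
    refine h1.mono' ?_ (Eventually.of_forall fun x => ?_)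
    · refine AEStronglyMeasurable.mul ?_ (continuous_pdR ψ i).aestronglyMeasurable
      exact (Real.measurable_log.comp_aemeasurable
        (((Lp.aestronglyMeasurable f).norm.aemeasurable.div_const ε).const_add
          1)).aestronglyMeasurable
    · rw [norm_mul]
      have h0 : 0 ≤ ‖f x‖ / ε := by positivity
      refine mul_le_mul ?_ (hK x) (norm_nonneg _) h0
      have := abs_log_one_add_sub_le h0 le_rfl
      simpa [abs_of_nonneg h0] using this
  have hlim : Tendsto (fun k => ∫ x in (Ω : Set (Rn n)), Real.log (1 + φ k x / ε) * pdR ψ i x)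
      atTop (𝓝 (∫ x in (Ω : Set (Rn n)), Real.log (1 + ‖f x‖ / ε) * pdR ψ i x)) := by
    rw [tendsto_iff_norm_sub_tendsto_zero]
    have h1 : Tendsto (fun k => K / ε * (√(volume.real (Ω : Set (Rn n))) *
        ‖fn (ofTestR (φ k)) - f‖)) atTop (𝓝 0) := by
      have := ((tendsto_iff_norm_sub_tendsto_zero.mp hf).const_mul
        (√(volume.real (Ω : Set (Rn n))))).const_mul (K / ε)
      simpa using this
    refine squeeze_zero (fun _ => norm_nonneg _) (fun k => ?_) h1
    have h2 : Integrable (fun x => Real.log (1 + φ k x / ε) * pdR ψ i x)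
        (volume.restrict (Ω : Set (Rn n))) :=
      integrable_test_mul (logTest (φ k) (hφ k) hε) (continuous_pdR ψ i)
    have h3 : Integrable (fun x => K / ε * ‖(fn (ofTestR (φ k)) - f : L2 Ω) x‖)
        (volume.restrict (Ω : Set (Rn n))) :=
      ((Lp.memLp (fn (ofTestR (φ k)) - f)).integrable (by norm_num)).norm.const_mul _
    rw [← integral_sub h2 hfi]
    refine (norm_integral_le_of_norm_le h3 ?_).trans ?_
    · filter_upwards [Lp.coeFn_sub (fn (ofTestR (φ k))) f, fn_ofTestR_ae (φ k)] with x h4 h5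
      rw [h4, Pi.sub_apply, h5, ← sub_mul, norm_mul]
      have h6 : ‖Real.log (1 + φ k x / ε) - Real.log (1 + ‖f x‖ / ε)‖ ≤
          ‖(φ k x : ℂ) - f x‖ / ε := by
        have hx := hφ k x
        refine (abs_log_one_add_sub_le (by positivity) (by positivity)).trans ?_
        rw [← sub_div, abs_div, abs_of_pos hε]
        gcongr
        have h7 := abs_norm_sub_norm_le (φ k x : ℂ) (f x)
        rwa [Complex.norm_real, Real.norm_of_nonneg hx] at h7
      calc ‖Real.log (1 + φ k x / ε) - Real.log (1 + ‖f x‖ / ε)‖ * ‖pdR ψ i x‖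
          ≤ ‖(φ k x : ℂ) - f x‖ / ε * K :=
            mul_le_mul h6 (hK x) (norm_nonneg _) (by positivity)
        _ = _ := by ring
    · rw [integral_const_mul]
      gcongr
      exact integral_norm_le_mul_norm _
  have hlim2 := (hB.const_mul 2).const_add
    (volume.real (Ω : Set (Rn n)) + 4 * ‖grad (ofTestR ψ)‖ ^ 2)
  rw [mul_zero, add_zero] at hlim2
  exact le_of_tendsto_of_tendsto' hlim.abs hlim2
    fun k => abs_integral_logTest_mul_pdR_le ha ψ (φ k) (hφ k) hε i

open Classical in
/-- When `f` is the `L²` limit of a nonnegative minimizing sequence, the indicator of `{f ≠ 0}` has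
zero weak gradient: it is the limit of `log (1 + |f| / ε) / log (1 / ε)` as `ε → 0`, and the
numerators have distributional derivatives bounded uniformly in `ε`. -/
lemma integral_indicator_ne_zero_mul_pdR [IsFiniteMeasure (volume.restrict (Ω : Set (Rn n)))]
    {a : ℝ} (ha : 0 ≤ a) (h : ∀ u : H10 Ω, 0 ≤ energy a u) {φ : ℕ → 𝓓(Ω, ℝ)}
    (hφ : ∀ k x, 0 ≤ φ k x) (hE : Tendsto (fun k => energy a (ofTestR (φ k))) atTop (𝓝 0))
    {f : L2 Ω} (hf : Tendsto (fun k => fn (ofTestR (φ k))) atTop (𝓝 f)) (ψ : 𝓓(Ω, ℝ))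
    (i : Fin n) :
    ∫ x in (Ω : Set (Rn n)), (if f x = 0 then 0 else 1) * pdR ψ i x = 0 := by
  obtain ⟨K, hK⟩ := exists_bound_pdR ψ i
  have hK0 : 0 ≤ K := (abs_nonneg _).trans (hK 0)
  have hεpos : ∀ k : ℕ, 0 < Real.exp (-((k : ℝ) + 1)) := fun k => Real.exp_pos _
  -- `log (1 + |f| / ε) / log (1 / ε)` with `ε = exp (-(k + 1))`
  let F : ℕ → Rn n → ℝ := fun k x =>
    ((k : ℝ) + 1)⁻¹ * Real.log (1 + ‖f x‖ / Real.exp (-((k : ℝ) + 1)))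
  have hlog : ∀ (k : ℕ) (t : ℝ), 0 ≤ t → Real.log (1 + t / Real.exp (-((k : ℝ) + 1))) ≤
      (k + 1) + Real.log (1 + t) := by
    intro k t ht
    have h1 : (1 : ℝ) ≤ Real.exp ((k : ℝ) + 1) := Real.one_le_exp (by positivity)
    calc Real.log (1 + t / Real.exp (-((k : ℝ) + 1)))
        ≤ Real.log (Real.exp ((k : ℝ) + 1) * (1 + t)) := by
          rw [Real.exp_neg, div_inv_eq_mul]
          refine Real.log_le_log (by positivity) ?_
          linarith
      _ = _ := by rw [Real.log_mul (Real.exp_pos _).ne' (by positivity), Real.log_exp]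
  have hF0 : ∀ k x, 0 ≤ F k x := fun k x => by
    have : 0 ≤ Real.log (1 + ‖f x‖ / Real.exp (-((k : ℝ) + 1))) :=
      Real.log_nonneg (by have : 0 ≤ ‖f x‖ / Real.exp (-((k : ℝ) + 1)) := by positivity
                          linarith)
    positivity
  have hF1 : ∀ k x, F k x ≤ 1 + ‖f x‖ := fun k x => by
    have h1 := hlog k ‖f x‖ (norm_nonneg _)
    have h2 := Real.log_le_sub_one_of_pos (show 0 < 1 + ‖f x‖ by positivity)
    simp only [F]
    rw [inv_mul_le_iff₀ (by positivity)]
    have h3 : 0 ≤ (k : ℝ) * ‖f x‖ := by positivity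
    linarith
  have hlim1 : ∀ x, Tendsto (fun k => F k x) atTop (𝓝 (if f x = 0 then 0 else 1)) := by
    intro x
    by_cases hx : f x = 0
    · simp [F, hx]
    · rw [if_neg hx]
      have ht : 0 < ‖f x‖ := norm_pos_iff.mpr hx
      have hconst : ∀ c : ℝ, Tendsto (fun k : ℕ => 1 + 1 / ((k : ℝ) + 1) * c) atTop (𝓝 1) := by
        intro c
        simpa using ((tendsto_one_div_add_atTop_nhds_zero_nat (𝕜 := ℝ)).mul_const c).const_add 1
      refine tendsto_of_tendsto_of_tendsto_of_le_of_le (hconst (Real.log ‖f x‖))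
        (hconst (Real.log (1 + ‖f x‖))) (fun k => ?_) (fun k => ?_)
      · have h1 : ((k : ℝ) + 1) + Real.log ‖f x‖ ≤
            Real.log (1 + ‖f x‖ / Real.exp (-((k : ℝ) + 1))) := by
          calc ((k : ℝ) + 1) + Real.log ‖f x‖ = Real.log (Real.exp ((k : ℝ) + 1) * ‖f x‖) := by
                rw [Real.log_mul (Real.exp_pos _).ne' ht.ne', Real.log_exp]
            _ ≤ _ := by
                rw [Real.exp_neg, div_inv_eq_mul]
                refine Real.log_le_log (by positivity) ?_
                linarith
        simp only [F]
        rw [le_inv_mul_iff₀ (by positivity)]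
        refine le_trans (le_of_eq ?_) h1
        field_simp
      · simp only [F]
        rw [inv_mul_le_iff₀ (by positivity)]
        refine (hlog k _ ht.le).trans (le_of_eq ?_)
        field_simp
  have hmeas : ∀ k, AEStronglyMeasurable (fun x => F k x * pdR ψ i x)
      (volume.restrict (Ω : Set (Rn n))) := fun k => by
    refine AEStronglyMeasurable.mul ?_ (continuous_pdR ψ i).aestronglyMeasurable
    exact ((Real.measurable_log.comp_aemeasurable
      (((Lp.aestronglyMeasurable f).norm.aemeasurable.div_const _).const_add
        1)).const_mul _).aestronglyMeasurable
  have hint : Integrable (fun x => (1 + ‖f x‖) * K) (volume.restrict (Ω : Set (Rn n))) :=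
    (((integrable_const _).add ((Lp.memLp f).integrable (by norm_num)).norm)).mul_const K
  have hlim2 : Tendsto (fun k => ∫ x in (Ω : Set (Rn n)), F k x * pdR ψ i x) atTop
      (𝓝 (∫ x in (Ω : Set (Rn n)), (if f x = 0 then 0 else 1) * pdR ψ i x)) := by
    refine tendsto_integral_of_dominated_convergence _ hmeas hint
      (fun k => Eventually.of_forall fun x => ?_)
      (Eventually.of_forall fun x => (hlim1 x).mul_const _)
    rw [norm_mul, Real.norm_of_nonneg (hF0 k x)]
    exact mul_le_mul (hF1 k x) (hK x) (norm_nonneg _) (by positivity)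
  have hlim3 : Tendsto (fun k => ∫ x in (Ω : Set (Rn n)), F k x * pdR ψ i x) atTop (𝓝 0) := by
    refine squeeze_zero_norm (a := fun k : ℕ => 1 / ((k : ℝ) + 1) *
      (volume.real (Ω : Set (Rn n)) + 4 * ‖grad (ofTestR ψ)‖ ^ 2)) (fun k => ?_) ?_
    · have h1 := abs_integral_log_mul_pdR_le ha h hφ hE hf ψ i (hεpos k)
      simp only [F, mul_assoc]
      rw [integral_const_mul, norm_mul, one_div, Real.norm_of_nonneg (by positivity)]
      exact mul_le_mul_of_nonneg_left h1 (by positivity)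
    · simpa using (tendsto_one_div_add_atTop_nhds_zero_nat (𝕜 := ℝ)).mul_const
        (volume.real (Ω : Set (Rn n)) + 4 * ‖grad (ofTestR ψ)‖ ^ 2)
  exact tendsto_nhds_unique hlim2 hlim3

/-! ### Functions with zero weak gradient on a connected set -/

lemma fderiv_eq_sum_pdR (ψ : 𝓓(Ω, ℝ)) (x v : Rn n) : fderiv ℝ ψ x v = ∑ i, v i * pdR ψ i x := by
  have hv : v = ∑ i, v i • EuclideanSpace.single i (1 : ℝ) := by
    simpa using ((EuclideanSpace.basisFun (Fin n) ℝ).sum_repr v).symm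
  conv_lhs => rw [hv]
  simp [pdR]

/-- A function with zero weak gradient is locally constant almost everywhere: its mollifications
have zero gradient. -/
lemma exists_ae_eq_const_ball {c : Rn n → ℝ} (hc : IntegrableOn c (Ω : Set (Rn n)))
    (h : ∀ (ψ : 𝓓(Ω, ℝ)) (i : Fin n), ∫ x in (Ω : Set (Rn n)), c x * pdR ψ i x = 0)
    {x₀ : Rn n} (hx₀ : x₀ ∈ Ω) :
    ∃ r > 0, ∃ v : ℝ, ∀ᵐ y, y ∈ Metric.ball x₀ r → c y = v := by
  obtain ⟨R, hR, hRΩ⟩ := Metric.isOpen_iff.mp Ω.isOpen x₀ hx₀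
  set r := R / 2 with hr
  have hr0 : 0 < r := by positivity
  set g : Rn n → ℝ := Set.indicator (Ω : Set (Rn n)) c with hg
  have hgi : Integrable g := hc.integrable_indicator Ω.isOpen.measurableSet
  let b : ℕ → ContDiffBump (0 : Rn n) := fun k =>
    ⟨r / (k + 1) / 2, r / (k + 1), by positivity, half_lt_self (by positivity)⟩
  let ρ : ℕ → Rn n → ℝ := fun k => (b k).normed volume
  have hρs : ∀ k, tsupport (ρ k) ⊆ Metric.closedBall 0 r := fun k => by
    rw [(b k).tsupport_normed_eq]
    refine Metric.closedBall_subset_closedBall ?_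
    exact div_le_self hr0.le (by linarith [(Nat.cast_nonneg k : (0 : ℝ) ≤ k)])
  have hρd : ∀ k, ContDiff ℝ ∞ (ρ k) := fun k => (b k).contDiff_normed
  have hρc : ∀ k, HasCompactSupport (ρ k) := fun k => (b k).hasCompactSupport_normed
  let F : ℕ → Rn n → ℝ := fun k =>
    convolution g (ρ k) (ContinuousLinearMap.lsmul ℝ ℝ) volume
  have hFd : ∀ k x, HasFDerivAt (F k) (convolution g (fderiv ℝ (ρ k))
      ((ContinuousLinearMap.lsmul ℝ ℝ).precompR (Rn n)) volume x) x := fun k x =>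
    (hρc k).hasFDerivAt_convolution_right (ContinuousLinearMap.lsmul ℝ ℝ) hgi.locallyIntegrable
      ((hρd k).of_le (by simp)) x
  have hF0 : ∀ k, ∀ x ∈ Metric.ball x₀ r, fderiv ℝ (F k) x = 0 := by
    intro k x hx
    rw [(hFd k x).fderiv]
    ext v
    rw [convolution_precompR_apply _ hgi.locallyIntegrable ((hρc k).fderiv ℝ)
      ((hρd k).continuous_fderiv (by simp)), convolution]
    -- the translate `t ↦ ρ (x - t)` of the mollifier is a test function in `Ω`
    have hsub : tsupport (fun t => ρ k (x - t)) ⊆ Metric.closedBall x r := by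
      refine closure_minimal (fun t ht => ?_) Metric.isClosed_closedBall
      have h1 := hρs k (subset_tsupport _ (show x - t ∈ Function.support (ρ k) from ht))
      rw [mem_closedBall_zero_iff] at h1
      rwa [Metric.mem_closedBall, dist_comm, dist_eq_norm]
    let ψ : 𝓓(Ω, ℝ) :=
      { toFun := fun t => ρ k (x - t)
        contDiff' := (hρd k).comp (contDiff_const.sub contDiff_id)
        hasCompactSupport' := HasCompactSupport.intro (isCompact_closedBall x r) fun t ht => by
          by_contra hne
          exact ht (hsub (subset_tsupport _ hne))
        tsupport_subset' := hsub.trans fun t ht => hRΩ (by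
          rw [Metric.mem_closedBall] at ht
          rw [Metric.mem_ball] at hx ⊢
          have := dist_triangle t x x₀
          linarith) }
    have hψ : ∀ t, fderiv ℝ (ρ k) (x - t) v = -fderiv ℝ ψ t v := by
      intro t
      have h1 : HasFDerivAt (ρ k) (fderiv ℝ (ρ k) (x - t)) (x - t) :=
        ((hρd k).differentiable (by simp)).differentiableAt.hasFDerivAt
      have h2 : HasFDerivAt ψ _ t := h1.comp t ((hasFDerivAt_id t).const_sub x)
      rw [h2.fderiv]
      simp
    have hint : ∀ i ∈ Finset.univ, Integrable (fun t => v i * (c t * pdR ψ i t))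
        (volume.restrict (Ω : Set (Rn n))) := fun i _ => by
      obtain ⟨K, hK⟩ := exists_bound_pdR ψ i
      exact (hc.mul_bdd (continuous_pdR ψ i).aestronglyMeasurable
        (Eventually.of_forall hK)).const_mul _
    calc ∫ t, ContinuousLinearMap.lsmul ℝ ℝ (g t) (fderiv ℝ (ρ k) (x - t) v)
        = -∫ t, Set.indicator (Ω : Set (Rn n)) (fun t => c t * fderiv ℝ ψ t v) t := by
          rw [← integral_neg]
          refine integral_congr_ae (Eventually.of_forall fun t => ?_)
          by_cases ht : t ∈ (Ω : Set (Rn n)) <;> simp [hg, ht, hψ]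
      _ = -∫ t in (Ω : Set (Rn n)), ∑ i, v i * (c t * pdR ψ i t) := by
          rw [integral_indicator Ω.isOpen.measurableSet]
          congr 1
          refine integral_congr_ae (Eventually.of_forall fun t => ?_)
          simp only [fderiv_eq_sum_pdR, Finset.mul_sum]
          exact Finset.sum_congr rfl fun i _ => by ring
      _ = 0 := by
          rw [integral_finsetSum _ hint]
          simp [integral_const_mul, h]
  have hlim : ∀ᵐ y, Tendsto (fun k => F k y) atTop (𝓝 (g y)) := by
    have h1 := ContDiffBump.ae_convolution_tendsto_right_of_locallyIntegrable (μ := volume)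
      (φ := b) (l := atTop) (K := 2) (g := g) ?_ ?_ hgi.locallyIntegrable
    · filter_upwards [h1] with y hy
      refine hy.congr fun k => ?_
      rw [convolution_eq_swap]
      simp only [F, ρ, convolution, ContinuousLinearMap.lsmul_apply, smul_eq_mul, mul_comm]
    · have := (tendsto_one_div_add_atTop_nhds_zero_nat (𝕜 := ℝ)).const_mul r
      simpa [b, div_eq_mul_inv] using this
    · refine Eventually.of_forall fun k => ?_
      simp only [b]
      linarith
  obtain ⟨y₀, hy₀, hy₀lim⟩ := (Measure.dense_of_ae hlim).exists_mem_open Metric.isOpen_ball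
    (Metric.nonempty_ball.mpr hr0 : (Metric.ball x₀ r).Nonempty)
  refine ⟨r, hr0, g y₀, ?_⟩
  filter_upwards [hlim] with y hy hyb
  have hcy : g y = c y := Set.indicator_of_mem (hRΩ (Metric.ball_subset_ball (by linarith) hyb)) c
  rw [← hcy]
  refine tendsto_nhds_unique hy (hy₀.congr fun k => ?_)
  exact Metric.isOpen_ball.is_const_of_fderiv_eq_zero (𝕜 := ℝ)
    (convex_ball x₀ r).isPreconnected
    (fun x _ => (hFd k x).differentiableAt.differentiableWithinAt) (hF0 k) hy₀lim hyb

open Classical in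
/-- On a connected set, an indicator function with zero weak gradient is constant. -/
lemma ae_eq_zero_or_ae_ne_zero (hconn : IsConnected (Ω : Set (Rn n)))
    [IsFiniteMeasure (volume.restrict (Ω : Set (Rn n)))] (f : L2 Ω)
    (h : ∀ (ψ : 𝓓(Ω, ℝ)) (i : Fin n),
      ∫ x in (Ω : Set (Rn n)), (if f x = 0 then 0 else 1) * pdR ψ i x = 0) :
    (∀ᵐ x ∂(volume.restrict (Ω : Set (Rn n))), f x = 0) ∨
      ∀ᵐ x ∂(volume.restrict (Ω : Set (Rn n))), f x ≠ 0 := by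
  have hc : IntegrableOn (fun x => if f x = 0 then (0 : ℝ) else 1) (Ω : Set (Rn n)) := by
    have hm : Measurable fun z : ℂ => if z = 0 then (0 : ℝ) else 1 :=
      Measurable.ite (measurableSet_singleton 0) measurable_const measurable_const
    refine (integrable_const (1 : ℝ)).mono'
      (hm.comp_aemeasurable (Lp.aestronglyMeasurable f).aemeasurable).aestronglyMeasurable
      (Eventually.of_forall fun x => ?_)
    by_cases hx : f x = 0 <;> simp [hx]
  let U : (Rn n → Prop) → Set (Rn n) := fun p =>
    {x | ∃ r > 0, ∀ᵐ y, y ∈ Metric.ball x r → p y}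
  have hUopen : ∀ p, IsOpen (U p) := by
    intro p
    rw [Metric.isOpen_iff]
    rintro x ⟨r, hr, hx⟩
    refine ⟨r, hr, fun y hy => ⟨r - dist y x, sub_pos.mpr hy, ?_⟩⟩
    filter_upwards [hx] with z hz hzy
    exact hz (Metric.ball_subset_ball' (by linarith) hzy)
  have hUae : ∀ p, (Ω : Set (Rn n)) ⊆ U p →
      ∀ᵐ x ∂(volume.restrict (Ω : Set (Rn n))), p x := by
    intro p hp
    rw [ae_restrict_iff' Ω.isOpen.measurableSet, ae_iff]
    refine measure_null_of_locally_null _ fun x hx => ?_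
    simp only [Classical.not_imp, Set.mem_ofPred_eq] at hx
    obtain ⟨r, hr, hx'⟩ := hp hx.1
    refine ⟨_, inter_mem_nhdsWithin _ (Metric.ball_mem_nhds x hr), ?_⟩
    refine measure_mono_null (fun y hy => ?_) (ae_iff.mp hx')
    simp only [Classical.not_imp, Set.mem_inter_iff, Set.mem_ofPred_eq] at hy ⊢
    exact ⟨hy.2, hy.1.2⟩
  have hcover : (Ω : Set (Rn n)) ⊆ U (fun x => f x = 0) ∪ U fun x => f x ≠ 0 := by
    intro x hx
    obtain ⟨r, hr, v, hv⟩ := exists_ae_eq_const_ball hc h hx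
    by_cases hv0 : v = 0
    · left
      refine ⟨r, hr, ?_⟩
      filter_upwards [hv] with y hy hyb
      by_contra hne
      have := hy hyb
      rw [if_neg hne, hv0] at this
      exact one_ne_zero this
    · right
      refine ⟨r, hr, ?_⟩
      filter_upwards [hv] with y hy hyb hne
      have := hy hyb
      rw [if_pos hne] at this
      exact hv0 this.symm
  have hdisj : (Ω : Set (Rn n)) ∩ (U (fun x => f x = 0) ∩ U fun x => f x ≠ 0) = ∅ := by
    rw [Set.eq_empty_iff_forall_notMem]
    rintro x ⟨_, ⟨r, hr, h1⟩, r', hr', h2⟩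
    have h3 : ∀ᵐ y, ¬ (y ∈ Metric.ball x (min r r')) := by
      filter_upwards [h1, h2] with y h4 h5 hy
      exact h5 (Metric.ball_subset_ball (min_le_right _ _) hy)
        (h4 (Metric.ball_subset_ball (min_le_left _ _) hy))
    obtain ⟨y, hy, hy'⟩ := (Measure.dense_of_ae h3).exists_mem_open Metric.isOpen_ball
      (Metric.nonempty_ball.mpr (lt_min hr hr') : (Metric.ball x (min r r')).Nonempty)
    exact hy hy'
  rcases isPreconnected_iff_subset_of_disjoint.mp hconn.isPreconnected _ _ (hUopen _) (hUopen _)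
    hcover hdisj with h1 | h1
  · exact Or.inl (hUae _ h1)
  · exact Or.inr (hUae _ h1)

/-! ### Simplicity of the least eigenvalue -/

/-- The strong maximum principle: the real part of a first eigenfunction vanishes almost
everywhere or almost nowhere. -/
lemma IsDirichlet.re_ae_eq_zero_or_ne_zero (hconn : IsConnected (Ω : Set (Rn n)))
    [IsFiniteMeasure (volume.restrict (Ω : Set (Rn n)))] {a : ℝ} (ha : 0 ≤ a)
    (h : ∀ u : H10 Ω, 0 ≤ energy a u) {u : H10 Ω} (hu : IsDirichlet (a : ℂ) u) :
    (∀ᵐ x ∂(volume.restrict (Ω : Set (Rn n))), (fn u x).re = 0) ∨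
      ∀ᵐ x ∂(volume.restrict (Ω : Set (Rn n))), (fn u x).re ≠ 0 := by
  obtain ⟨-, φ, hφ, hE, hf⟩ := hu.exists_minimizing h
  have h1 := ae_eq_zero_or_ae_ne_zero hconn (absReL2 (fn u))
    fun ψ i => integral_indicator_ne_zero_mul_pdR ha h hφ hE hf ψ i
  refine h1.imp (fun h2 => ?_) (fun h2 => ?_)
  · filter_upwards [h2, absReL2_ae (fn u)] with x h3 h4
    rw [h4] at h3
    simpa using h3
  · filter_upwards [h2, absReL2_ae (fn u)] with x h3 h4
    rw [h4] at h3
    simpa using h3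

/-- A first eigenfunction with zero mean has vanishing real part. The function `|Re u| - Re u` is a
first eigenfunction too, so it vanishes or is positive almost everywhere: `Re u` has a sign, and its
mean is zero. -/
lemma IsDirichlet.re_ae_eq_zero_of_integral_eq_zero (hconn : IsConnected (Ω : Set (Rn n)))
    [IsFiniteMeasure (volume.restrict (Ω : Set (Rn n)))] {a : ℝ} (ha : 0 < a)
    (h : ∀ u : H10 Ω, 0 ≤ energy a u) {u : H10 Ω} (hu : IsDirichlet (a : ℂ) u)
    (hint : ∫ x in (Ω : Set (Rn n)), fn u x = 0) :
    ∀ᵐ x ∂(volume.restrict (Ω : Set (Rn n))), (fn u x).re = 0 := by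
  have hi : Integrable (fn u) (volume.restrict (Ω : Set (Rn n))) :=
    (Lp.memLp (fn u)).integrable (by norm_num)
  have hre : ∫ x in (Ω : Set (Rn n)), (fn u x).re = 0 := by
    have := integral_re hi
    rw [hint] at this
    simpa using this
  obtain ⟨⟨φ₁, hE₁, hf₁⟩, φ₂, -, hE₂, hf₂⟩ := hu.exists_minimizing h
  obtain ⟨r, hr, hfr⟩ := exists_isDirichlet_of_tendsto ha h hE₁ hf₁
  obtain ⟨s, hs, hfs⟩ := exists_isDirichlet_of_tendsto ha h hE₂ hf₂
  have hsr : IsDirichlet (a : ℂ) (s - r) := fun v => by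
    rw [grad_sub, fn_sub, inner_sub_right, inner_sub_right, hs v, hr v, mul_sub]
  have hval : ∀ᵐ x ∂(volume.restrict (Ω : Set (Rn n))),
      (fn (s - r) x).re = |(fn u x).re| - (fn u x).re := by
    rw [fn_sub, hfr, hfs]
    filter_upwards [Lp.coeFn_sub (absReL2 (fn u)) (reL2 (fn u)), absReL2_ae (fn u),
      reL2_ae (fn u)] with x h1 h2 h3
    rw [h1, Pi.sub_apply, h2, h3]
    simp
  have habs : ∫ x in (Ω : Set (Rn n)), |(fn u x).re| = 0 := by
    rcases hsr.re_ae_eq_zero_or_ne_zero hconn ha.le h with h1 | h1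
    · rw [← hre]
      refine integral_congr_ae ?_
      filter_upwards [h1, hval] with x h2 h3
      rw [h2] at h3
      linarith
    · rw [← neg_zero, ← hre, ← integral_neg]
      refine integral_congr_ae ?_
      filter_upwards [h1, hval] with x h2 h3
      rw [h3] at h2
      refine abs_of_nonpos ?_
      by_contra! h4
      exact h2 (by rw [abs_of_pos h4, sub_self])
  have h2 := (integral_eq_zero_iff_of_nonneg (fun x => abs_nonneg _) hi.re.abs).mp habs
  filter_upwards [h2] with x hx
  exact abs_eq_zero.mp hx

/-- The least eigenvalue is simple: on the space of first eigenfunctions the mean value is an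
injective functional, because it also applies to `i u`. -/
theorem finrank_eigenspace_le_one (hn : 1 ≤ n) (hconn : IsConnected (Ω : Set (Rn n)))
    (hbdd : Bornology.IsBounded (Ω : Set (Rn n))) {a : ℝ} (ha : 0 < a)
    (h : ∀ u : H10 Ω, 0 ≤ energy a u) : Module.finrank ℂ (eigenspace Ω (a : ℂ)) ≤ 1 := by
  have : IsFiniteMeasure (volume.restrict (Ω : Set (Rn n))) :=
    ⟨by simpa using hbdd.measure_lt_top⟩
  let I : H10 Ω →ₗ[ℂ] ℂ := (innerSL ℂ (indicatorConstLp 2 MeasurableSet.univ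
    (measure_ne_top _ _) (1 : ℂ) : L2 Ω)).toLinearMap ∘ₗ (fnL (Ω := Ω)).toLinearMap
  have hI : ∀ u, I u = ∫ x in (Ω : Set (Rn n)), fn u x := fun u => by
    have := L2.inner_indicatorConstLp_one (𝕜 := ℂ) (μ := volume.restrict (Ω : Set (Rn n)))
      MeasurableSet.univ (measure_ne_top _ _) (fn u)
    simpa [I] using this
  have hinj : Function.Injective (I ∘ₗ (eigenspace Ω (a : ℂ)).subtype) := by
    rw [← LinearMap.ker_eq_bot, LinearMap.ker_eq_bot']
    rintro ⟨u, hu⟩ hIu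
    have hIu' : I u = 0 := hIu
    have hu' := (mem_eigenspace_iff hn hbdd).mp hu
    have hiu : IsDirichlet (a : ℂ) (Complex.I • u) :=
      (mem_eigenspace_iff hn hbdd).mp ((eigenspace Ω (a : ℂ)).smul_mem _ hu)
    have h1 := hu'.re_ae_eq_zero_of_integral_eq_zero hconn ha h (by rw [← hI, hIu'])
    have h2 := hiu.re_ae_eq_zero_of_integral_eq_zero hconn ha h
      (by rw [← hI, map_smul, hIu', smul_zero])
    have h3 : fn u = 0 := by
      refine Lp.ext ?_
      filter_upwards [h1, h2, Lp.coeFn_smul Complex.I (fn u),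
        Lp.coeFn_zero ℂ 2 (volume.restrict (Ω : Set (Rn n)))] with x h3 h4 h5 h6
      rw [h6]
      rw [fn_smul, h5] at h4
      refine Complex.ext h3 ?_
      simpa using h4
    exact Subtype.ext (fn_eq_zero_iff.mp h3)
  simpa using LinearMap.finrank_le_finrank_of_injective hinj

end FOSLS

end

theorem mainTheorem9 (n : ℕ) (hn : 1 ≤ n) (Ω : Opens (EuclideanSpace ℝ (Fin n)))
    (hconn : IsConnected (Ω : Set (EuclideanSpace ℝ (Fin n))))
    (hbdd : Bornology.IsBounded (Ω : Set (EuclideanSpace ℝ (Fin n)))) :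
    ∃ lam : ℕ → ℝ,
      0 < lam 0 ∧ lam 0 < lam 1 ∧ Monotone lam ∧ Tendsto lam atTop atTop ∧
      (∀ z : ℂ, FOSLS.IsEigenvalue Ω z ↔ ∃ k, z = (lam k : ℂ)) ∧
      (∀ z : ℂ, FiniteDimensional ℂ (FOSLS.eigenspace Ω z) ∧
        Module.finrank ℂ (FOSLS.eigenspace Ω z) = {k | (lam k : ℂ) = z}.ncard) ∧
      (⨆ k, FOSLS.eigenspace Ω (lam k : ℂ)).topologicalClosure = ⊤ := by
  have hfd := FOSLS.finiteDimensional_eigenspace hn hbdd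
  have hrank : ∀ z : ℂ, Module.finrank ℂ (FOSLS.eigenspace Ω z) ≠ 0 ↔
      FOSLS.eigenspace Ω z ≠ ⊥ := fun z => by
    have := hfd z
    rw [Ne, Submodule.finrank_eq_zero]
  obtain ⟨lam, hmono, htends, hcard⟩ := FOSLS.exists_monotone_enumeration
    (fun x : ℝ => Module.finrank ℂ (FOSLS.eigenspace Ω (x : ℂ)))
    (by simpa only [hrank] using FOSLS.finite_eigenvalues_le hn hbdd)
    (by simpa only [hrank] using FOSLS.infinite_eigenvalues hn hconn.nonempty hbdd)
  have hfinite : ∀ x : ℝ, {k | lam k = x}.Finite := by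
    intro x
    obtain ⟨N, hN⟩ := eventually_atTop.mp (htends.eventually_gt_atTop x)
    refine (Set.finite_lt_nat N).subset fun k hk => ?_
    by_contra hlt
    exact (hN k (not_lt.mp hlt)).ne' hk
  have hne : ∀ x : ℝ, FOSLS.eigenspace Ω (x : ℂ) ≠ ⊥ ↔ ∃ k, lam k = x := by
    intro x
    rw [← hrank, ← hcard, Ne, Set.ncard_eq_zero (hfinite x), ← Ne, ← Set.nonempty_iff_ne_empty]
    rfl
  have hpos : ∀ k, 0 < lam k := fun k =>
    FOSLS.pos_of_eigenspace_ne_bot hn hbdd ((hne _).mpr ⟨k, rfl⟩)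
  have hdir : ∀ (z : ℂ) (u : FOSLS.H10 Ω), u ≠ 0 → u ∈ FOSLS.eigenspace Ω z →
      ∃ k, z = (lam k : ℂ) := by
    intro z u hu0 hu
    obtain ⟨x, -, rfl⟩ := ((FOSLS.mem_eigenspace_iff hn hbdd).mp hu).exists_real hn hbdd hu0
    obtain ⟨k, hk⟩ := (hne x).mp fun h => hu0 ((Submodule.eq_bot_iff _).mp h u hu)
    exact ⟨k, by rw [hk]⟩
  refine ⟨lam, hpos 0, ?_, hmono, htends, fun z => ?_, fun z => ⟨hfd z, ?_⟩, ?_⟩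
  -- if `lam 0 = lam 1`, the least eigenvalue has multiplicity at least two
  · refine lt_of_le_of_ne (hmono zero_le_one) fun h01 => ?_
    have h1 : Module.finrank ℂ (FOSLS.eigenspace Ω (lam 0 : ℂ)) ≤ 1 :=
      FOSLS.finrank_eigenspace_le_one hn hconn hbdd (hpos 0) fun u => by
        have := FOSLS.mul_norm_sq_le_of_le_eigenvalues hn hbdd (hpos 0) (fun x hx => by
          obtain ⟨k, rfl⟩ := (hne x).mp hx
          exact hmono (Nat.zero_le k)) u
        rw [FOSLS.energy]
        linarith
    have h2 := hcard (lam 0)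
    have h3 : ({0, 1} : Set ℕ).ncard ≤ {k | lam k = lam 0}.ncard :=
      Set.ncard_le_ncard (by rintro k (rfl | rfl) <;> simp [h01]) (hfinite _)
    rw [Set.ncard_pair zero_ne_one] at h3
    omega
  · rw [FOSLS.isEigenvalue_iff hn hbdd]
    constructor
    · rintro ⟨x, -, rfl, hx⟩
      obtain ⟨k, hk⟩ := (hne x).mp hx
      exact ⟨k, by rw [hk]⟩
    · rintro ⟨k, rfl⟩
      exact ⟨lam k, hpos k, rfl, (hne _).mpr ⟨k, rfl⟩⟩
  · by_cases hz : ∃ x : ℝ, z = x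
    · obtain ⟨x, rfl⟩ := hz
      rw [← hcard x]
      simp
    -- a number that is not real is not an eigenvalue, and the sequence does not contain it
    · have h1 : {k | (lam k : ℂ) = z} = ∅ :=
        Set.eq_empty_of_forall_notMem fun k hk => hz ⟨lam k, hk.symm⟩
      rw [h1, Set.ncard_empty]
      by_contra h0
      obtain ⟨u, hu, hu0⟩ := Submodule.exists_mem_ne_zero_of_ne_bot ((hrank z).mp h0)
      obtain ⟨k, hk⟩ := hdir z u hu0 hu
      exact hz ⟨_, hk⟩
  · rw [Submodule.topologicalClosure_eq_top_iff, Submodule.eq_bot_iff]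
    intro w hw
    refine FOSLS.eq_zero_of_orthogonal_dirichlet hbdd fun z u hu0 hz => ?_
    have hu := (FOSLS.mem_eigenspace_iff hn hbdd).mpr hz
    obtain ⟨k, rfl⟩ := hdir z u hu0 hu
    exact (Submodule.mem_orthogonal _ _).mp hw u (Submodule.mem_iSup_of_mem k hu)
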